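/- Fix an alphabet $[1..a]$, an involution $f$ of it, a prime $p\ge a$ and a base $b$. The fingerprint of a string $s[1..n]$ is $\kappa(s)=\left(\sum_{i=0}^{n-1}s[n-i]\,b^i\right)\bmod p$. A *forest of enhanced splay trees* (FeST) keeps a collection of dynamic strings, one splay tree per string, the symbol $s[k]$ being stored at the node of in-order $k$. A node $x$ whose subtree represents the string $u$ stores two child pointers, its symbol, the size $|u|$, $b^{|u|}\bmod p$, the fingerprints of $u$, of the reverse of $u$, of $f(u)$ and of the reverse of $f(u)$ (where $f$ is applied symbolwise), and two marks saying that a reversal, respectively an application of $f$, of the whole subtree is still pending; these are pushed to the children when the node is accessed. All operations are carried out by splaying, where the primitive $\mathrm{isolate}(i,j)$ makes $s[i..j]$ the string of a single subtree by at most two splays, the second of which, if it would end in a zig-zig, ends in two zigs instead. The collection is initially empty. The operations are: make-string$(w)$ (create a string); access$(s,i)$ (return $s[i]$); retrieve$(s,i,j)$ (return $s[i..j]$); substitute$(s,i,c)$, insert$(s,i,c)$, delete$(s,i)$; introduce$(s_1,i,s_2)$ (replace $s_1$ by $s_1[..i-1]\,s_2\,s_1[i..]$ and destroy $s_2$, where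 $s_1, s_2$ are different members of the collection); extract$(s,i,j)$ (remove $s[i..j]$ from $s$ and make it a new string); reverse$(s,i,j)$ (reverse $s[i..j]$ in $s$); map$(s,i,j)$ (apply $f$ to all symbols of $s[i..j]$ in $s$); and equal$(s_1,i_1,s_2,i_2,\ell)$ (decide whether $s_1[i_1..i_1+\ell-1]=s_2[i_2..i_2+\ell-1]$, where $s_1=s_2$ is allowed, by comparing the fingerprints of the isolated substrings). Time is counted in steps, each of a constant number of word-RAM operations on node records and on integers modulo $p$ or at most the total length of the collection. There is an absolute constant $C$ such that the following holds for every sequence of legal operations, started from the empty collection. 1. (Correctness.) For every base $b$, the forest represents the collection obtained by performing the operations exactly, all its nodes carry the sizes, powers and fingerprints described above, and all operations other than equal return the exact answer. If equal answers negatively, then the two substrings are different. 2. (Space.) If the collection has total length $N$ and contains $e$ empty strings, the forest takes at most $C(N+e)$ words (so $O(N)$ words if there are no empty strings). 3. (Time.) For every base $b$, the total time of the sequence is at most $C$ times the sum of the following amortized bounds, in which lengths are taken just before the operation: $|w|+1$ for make-string$(w)$; $\ell+\log_2(|s|+2)$ for retrieve$(s,i,j)$, where $\ell=j-i+1$; $\log_2(|s_1|+|s_2|+2)$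 for introduce$(s_1,i,s_2)$ and for equal$(s_1,i_1,s_2,i_2,\ell)$; and $\log_2(|s|+2)$ for access, substitute, insert, delete, extract, reverse and map on the string $s$. The linear terms are also worst-case: a single make-string$(w)$ takes at most $C(|w|+1)$ steps, and a single retrieve$(s,i,j)$ takes at most $C(\ell+1)$ steps more than $\mathrm{isolate}(i,j)$ on the tree of $s$. 4. (Substring equality whp.) Let $c,N\ge 0$ be integers such that $p\ge N^{c+1}$, and suppose that the base $b$ is chosen uniformly at random from $[1..p-1]$, the sequence of operations being fixed independently of $b$. If after this sequence the collection has total length at most $N$, then a legal operation equal performed next answers correctly with probability at least $1-1/N^c$ (where $1/0$ is read as $0$). -/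

import Mathlib

namespace FeST

/-! ### Step counting -/

/-- A result together with the number of steps used to compute it.  One step stands for a constant
number of elementary operations of a word RAM: reading or writing the fields of one node record,
following a pointer, allocating or freeing a record, and arithmetic, comparisons and logical
operations on machine words.  Every recursive call below is charged at least one step. -/
structure Timed (α : Type) where
  val : α
  time : ℕ

instance : Monad Timed where
  pure x := ⟨x, 0⟩
  bind x g := ⟨(g x.val).val, x.time + (g x.val).time⟩

/-- Charge one step and return `x`. -/
def tick {α : Type} (x : α) : Timed α := ⟨x, 1⟩

/-- Charge one step and continue with `x`. -/
def step {α : Type} (x : Timed α) : Timed α := ⟨x.val, x.time + 1⟩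

/-! ### Karp-Rabin fingerprints

The alphabet `[1..a]` is modelled by `Fin a`, the element `c` standing for the integer `c + 1`. -/

/-- The integer symbol denoted by `c`, modulo `p`. -/
def code {a : ℕ} (p : ℕ) (c : Fin a) : ZMod p := ((c.val + 1 : ℕ) : ZMod p)

/-- `κ(s) = ∑_{i=0}^{n-1} s[n-i] * b^i mod p`, where `n = |s|` and positions start at `1`. -/
def fingerprint {a p : ℕ} (b : ZMod p) (s : List (Fin a)) : ZMod p :=
  ∑ i : Fin s.length, code p (s.get i.rev) * b ^ (i : ℕ)

/-! ### Enhanced binary trees -/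

/-- The fields of a node record other than the two child pointers.  `fp`, `fprev`, `mfp`, `mfprev`
are for the fingerprints of the represented string, of its reverse, of its image under the
involution, and of the reverse of that image.  `rev` and `map` mark a reversal, respectively a
mapping, of the whole subtree that has not been carried out yet. -/
structure Fields (a p : ℕ) where
  char : Fin a
  size : ℕ
  power : ZMod p
  fp : ZMod p
  fprev : ZMod p
  mfp : ZMod p
  mfprev : ZMod p
  rev : Bool
  map : Bool

/-- A tree given by its root; `null` is the null pointer. -/
inductive Tree (a p : ℕ) where
  | null : Tree a p
  | node (left : Tree a p) (x : Fields a p) (right : Tree a p) : Tree a p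

namespace Tree

variable {a p : ℕ}

/-- The actual number of nodes. -/
def count : Tree a p → ℕ
  | null => 0
  | node l _ r => l.count + 1 + r.count

def size : Tree a p → ℕ
  | null => 0
  | node _ x _ => x.size

def power : Tree a p → ZMod p
  | null => 1
  | node _ x _ => x.power

def fp : Tree a p → ZMod p
  | null => 0
  | node _ x _ => x.fp

def fprev : Tree a p → ZMod p
  | null => 0
  | node _ x _ => x.fprev

def mfp : Tree a p → ZMod p
  | null => 0
  | node _ x _ => x.mfp

def mfprev : Tree a p → ZMod p
  | null => 0
  | node _ x _ => x.mfprev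

/-- Flip the reversal mark of the root. -/
def toggleRev : Tree a p → Tree a p
  | null => null
  | node l x r => node l { x with rev := !x.rev } r

/-- Flip the mapping mark of the root. -/
def toggleMap : Tree a p → Tree a p
  | null => null
  | node l x r => node l { x with map := !x.map } r

/-- Carry out a pending reversal at the root, passing the mark on to the children. -/
def fix : Tree a p → Tree a p
  | null => null
  | node l x r =>
    if x.rev then
      node r.toggleRev
        { x with rev := false, fp := x.fprev, fprev := x.fp, mfp := x.mfprev, mfprev := x.mfp }
        l.toggleRev
    else node l x r

/-- Carry out a pending mapping at the root, passing the mark on to the children. -/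
def fixm (f : Fin a → Fin a) : Tree a p → Tree a p
  | null => null
  | node l x r =>
    if x.map then
      node l.toggleMap
        { x with
          char := f x.char, map := false, fp := x.mfp, mfp := x.fp, fprev := x.mfprev,
          mfprev := x.fprev }
        r.toggleMap
    else node l x r

/-- What is done to a node whenever it is accessed. -/
def visit (f : Fin a → Fin a) (t : Tree a p) : Tree a p := (t.fix).fixm f

/-- The string represented by a tree, pending marks being taken into account. -/
def str (f : Fin a → Fin a) : Tree a p → List (Fin a)
  | null => []
  | node l x r =>
    let s := l.str f ++ x.char :: r.str f
    let s' := if x.rev then s.reverse else s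
    if x.map then s'.map f else s'

/-- The fields of every node have their intended values: for a node with marks, they refer to the
string represented by the node before the marks of this node are carried out. -/
def WellFormed (b : ZMod p) (f : Fin a → Fin a) : Tree a p → Prop
  | null => True
  | node l x r =>
    l.WellFormed b f ∧ r.WellFormed b f ∧
      x.size = (l.str f ++ x.char :: r.str f).length ∧
      x.power = b ^ (l.str f ++ x.char :: r.str f).length ∧
      x.fp = fingerprint b (l.str f ++ x.char :: r.str f) ∧
      x.fprev = fingerprint b (l.str f ++ x.char :: r.str f).reverse ∧
      x.mfp = fingerprint b ((l.str f ++ x.char :: r.str f).map f) ∧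
      x.mfprev = fingerprint b ((l.str f ++ x.char :: r.str f).map f).reverse

theorem count_toggleRev (t : Tree a p) : t.toggleRev.count = t.count := by
  cases t <;> rfl

theorem count_toggleMap (t : Tree a p) : t.toggleMap.count = t.count := by
  cases t <;> rfl

theorem count_fix (t : Tree a p) : t.fix.count = t.count := by
  cases t with
  | null => rfl
  | node l x r =>
    simp only [fix]
    split
    · simp only [count, count_toggleRev]; omega
    · rfl

theorem count_fixm (f : Fin a → Fin a) (t : Tree a p) : (t.fixm f).count = t.count := by
  cases t with
  | null => rfl
  | node l x r =>
    simp only [fixm]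
    split
    · simp only [count, count_toggleMap]
    · rfl

theorem count_visit (f : Fin a → Fin a) (t : Tree a p) : (t.visit f).count = t.count := by
  rw [visit, count_fixm, count_fix]

theorem count_left_lt {f : Fin a → Fin a} {t l r : Tree a p} {x : Fields a p}
    (h : t.visit f = node l x r) : l.count < t.count := by
  rw [← count_visit f t, h]; simp only [count]; omega

theorem count_right_lt {f : Fin a → Fin a} {t l r : Tree a p} {x : Fields a p}
    (h : t.visit f = node l x r) : r.count < t.count := by
  rw [← count_visit f t, h]; simp only [count]; omega

end Tree

/-! ### Splaying

The functions below work on a path from a node up to the root, listed from the node upwards. -/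

/-- One edge of a path from a node to the root: `left c r` says that we are the left child of a node
with symbol `c` and right child `r`, and `right l c` that we are the right child of a node with
left child `l` and symbol `c`. -/
inductive Frame (a p : ℕ) where
  | left (c : Fin a) (r : Tree a p) : Frame a p
  | right (l : Tree a p) (c : Fin a) : Frame a p

section Algorithms

variable {a p : ℕ} (b : ZMod p) (f : Fin a → Fin a)

/-- The (re)written record of an unmarked node with given children and symbol; its fields are
computed from those of the children, which are accessed and hence fixed first. -/
def mk (l₀ : Tree a p) (c : Fin a) (r₀ : Tree a p) : Timed (Tree a p) :=
  let l := l₀.visit f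
  let r := r₀.visit f
  tick <| .node l
    { char := c
      size := l.size + 1 + r.size
      power := l.power * b * r.power
      fp := (l.fp * b + code p c) * r.power + r.fp
      fprev := (r.fprev * b + code p c) * l.power + l.fprev
      mfp := (l.mfp * b + code p (f c)) * r.power + r.mfp
      mfprev := (r.mfprev * b + code p (f c)) * l.power + l.mfprev
      rev := false
      map := false } r

/-- Descend from the root of `t` to its node of in-order `i`, fixing all nodes on the way.  The
result is the path from that node to the root, the left subtree, symbol and right subtree of the
node; it is `none` if there is no such node. -/
def descend (t : Tree a p) (i : ℕ) (path : List (Frame a p)) :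
    Timed (Option (List (Frame a p) × Tree a p × Fin a × Tree a p)) :=
  match _h : t.visit f with
  | .null => tick none
  | .node l x r =>
    if i = l.size + 1 then tick (some (path, l, x.char, r))
    else if i < l.size + 1 then step (descend l i (.left x.char r :: path))
    else step (descend r (i - (l.size + 1)) (.right l x.char :: path))
termination_by t.count
decreasing_by
  · exact Tree.count_left_lt _h
  · exact Tree.count_right_lt _h

/-- Splay a node with subtrees `A`, `B` along the path to the root; the result is the pair of
subtrees of the node once it is the root.  If `final` is `true`, then a zig-zig that would bring the
node to the root is replaced by two zigs, made bottom-up. -/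
def splayUp (final : Bool) : List (Frame a p) → Tree a p → Tree a p →
    Timed (Tree a p × Tree a p)
  | [], A, B => pure (A, B)
  -- zig
  | [.left y C], A, B => do
    let B' ← mk b f B y C
    return (A, B')
  | [.right C y], A, B => do
    let A' ← mk b f C y A
    return (A', B)
  -- zig-zig
  | .left y C :: .left z D :: path, A, B =>
    if final && path.isEmpty then do
      let B' ← mk b f B y C
      let B'' ← mk b f B' z D
      return (A, B'')
    else do
      let Z ← mk b f C z D
      let B' ← mk b f B y Z
      splayUp final path A B'
  | .right C y :: .right D z :: path, A, B =>
    if final && path.isEmpty then do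
      let A' ← mk b f C y A
      let A'' ← mk b f D z A'
      return (A'', B)
    else do
      let Z ← mk b f D z C
      let A' ← mk b f Z y A
      splayUp final path A' B
  -- zig-zag
  | .right C y :: .left z D :: path, A, B => do
    let A' ← mk b f C y A
    let B' ← mk b f B z D
    splayUp final path A' B'
  | .left y C :: .right D z :: path, A, B => do
    let A' ← mk b f D z A
    let B' ← mk b f B y C
    splayUp final path A' B'

/-- Find the node of in-order `i` and splay it to the root. -/
def find (final : Bool) (t : Tree a p) (i : ℕ) : Timed (Tree a p) := do
  match ← descend f t i [] with
  | none => return t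
  | some (path, l, c, r) =>
    let (A, B) ← splayUp b f final path l r
    mk b f A c B

/-- Rearrange `t` so that the substring at positions `i, …, j` (with `1 ≤ i ≤ j + 1` and `j` at
most the length) is represented by one subtree.  The result is this subtree with the path from it
to the root, which has at most two edges. -/
def isolate (t : Tree a p) (i j : ℕ) : Timed (Tree a p × List (Frame a p)) :=
  step <|
  if i = 1 then
    if j = t.size then return (t, [])
    else do
      match ← find b f false t (j + 1) with
      | .null => return (.null, [])
      | .node l x r => return (l, [.left x.char r])
  else
    if j = t.size then do
      match ← find b f false t (i - 1) with
      | .null => return (.null, [])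
      | .node l x r => return (r, [.right l x.char])
    else do
      let t₁ ← find b f false t (j + 1)
      match ← find b f true t₁ (i - 1) with
      | .null => return (.null, [])
      | .node l x r =>
        match r.visit f with
        | .null => return (.null, [.right l x.char])
        | .node l' x' r' => return (l', [.left x'.char r', .right l x.char])

/-- Attach a subtree at the lower end of a path and recompute the fields of the nodes on it. -/
def plug : Tree a p → List (Frame a p) → Timed (Tree a p)
  | t, [] => pure t
  | t, .left c r :: path => do
    let t' ← mk b f t c r
    plug t' path
  | t, .right l c :: path => do
    let t' ← mk b f l c t
    plug t' path

/-! ### The operations on trees -/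

/-- A perfectly balanced tree for the first `n` symbols of `w`, and the remaining symbols. -/
def build : ℕ → List (Fin a) → Timed (Tree a p × List (Fin a))
  | 0, w => tick (.null, w)
  | n + 1, w => do
    let (l, w₁) ← build (n / 2) w
    match w₁ with
    | [] => return (l, [])
    | c :: w₂ =>
      let (r, w₃) ← build (n - n / 2) w₂
      let t ← mk b f l c r
      return (t, w₃)

def makeString (w : List (Fin a)) : Timed (Tree a p) := do
  let (t, _) ← build b f w.length w
  return t

/-- In-order traversal from right to left, fixing all nodes on the way and pushing the symbols onto
the front of `acc`.  The result is the fixed tree and the output. -/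
def traverse (t : Tree a p) (acc : List (Fin a)) : Timed (Tree a p × List (Fin a)) :=
  match _h : t.visit f with
  | .null => tick (.null, acc)
  | .node l x r =>
    step do
      let (r', acc₁) ← traverse r acc
      let (l', acc₂) ← traverse l (x.char :: acc₁)
      return (.node l' x r', acc₂)
termination_by t.count
decreasing_by
  · exact Tree.count_right_lt _h
  · exact Tree.count_left_lt _h

def access (t : Tree a p) (i : ℕ) : Timed (Tree a p × Option (Fin a)) := do
  match ← find b f false t i with
  | .null => return (.null, none)
  | .node l x r => return (.node l x r, some x.char)

def retrieve (t : Tree a p) (i j : ℕ) : Timed (Tree a p × List (Fin a)) := do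
  let (y, path) ← isolate b f t i j
  let (y', w) ← traverse f y []
  let t' ← plug b f y' path
  return (t', w)

def substitute (t : Tree a p) (i : ℕ) (c : Fin a) : Timed (Tree a p) := do
  match ← find b f false t i with
  | .null => return .null
  | .node l _ r => mk b f l c r

def insert (t : Tree a p) (i : ℕ) (c : Fin a) : Timed (Tree a p) :=
  if i ≤ t.size then do
    match ← find b f false t i with
    | .null => return .null
    | .node l x r =>
      let x' ← mk b f .null x.char r
      mk b f l c x'
  else mk b f t c .null

/-- Join two trees, all nodes of the second one going to the right of those of the first one. -/
def join (l r : Tree a p) : Timed (Tree a p) :=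
  match l with
  | .null => return r
  | .node .. => do
    match ← find b f false l l.size with
    | .null => return r
    | .node l' x _ => mk b f l' x.char r

def delete (t : Tree a p) (i : ℕ) : Timed (Tree a p) := do
  match ← find b f false t i with
  | .null => return .null
  | .node l _ r => join b f l r

def introduce (t₁ : Tree a p) (i : ℕ) (t₂ : Tree a p) : Timed (Tree a p) := do
  let (_, path) ← isolate b f t₁ i (i - 1)
  plug b f t₂ path

/-- The remaining tree and the extracted one. -/
def extract (t : Tree a p) (i j : ℕ) : Timed (Tree a p × Tree a p) := do
  let (y, path) ← isolate b f t i j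
  let t' ← plug b f .null path
  return (t', y)

def reverse (t : Tree a p) (i j : ℕ) : Timed (Tree a p) := do
  let (y, path) ← isolate b f t i j
  plug b f y.toggleRev path

def map (t : Tree a p) (i j : ℕ) : Timed (Tree a p) := do
  let (y, path) ← isolate b f t i j
  plug b f y.toggleMap path

/-- The fingerprint of the substring at positions `i, …, j`, read off its isolated subtree. -/
def substringFp (t : Tree a p) (i j : ℕ) : Timed (Tree a p × ZMod p) := do
  let (y, path) ← isolate b f t i j
  let κ := (y.visit f).fp
  let t' ← plug b f y path
  return (t', κ)

end Algorithms

/-! ### Collections of dynamic strings and their operations -/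

/-- The operations.  Dynamic strings are referred to by handles; all positions start at `1`. -/
inductive Op (a : ℕ) where
  | makeString (w : List (Fin a))
  | access (h i : ℕ)
  | retrieve (h i j : ℕ)
  | substitute (h i : ℕ) (c : Fin a)
  | insert (h i : ℕ) (c : Fin a)
  | delete (h i : ℕ)
  | introduce (h₁ i h₂ : ℕ)
  | extract (h i j : ℕ)
  | equal (h₁ i₁ h₂ i₂ len : ℕ)
  | reverse (h i j : ℕ)
  | map (h i j : ℕ)

/-- What an operation returns. -/
inductive Answer (a : ℕ) where
  | done
  | handle (h : ℕ)
  | symbol (c : Option (Fin a))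
  | string (w : List (Fin a))
  | bool (v : Bool)

/-- The object with handle `h`, if there is one: handles are given out in increasing order, and the
entry of a destroyed object is `none`. -/
def lookup {α : Type} (L : List (Option α)) (h : ℕ) : Option α := (L[h]?).join

/-- A collection of strings. -/
abbrev Collection (a : ℕ) := List (Option (List (Fin a)))

namespace Collection

variable {a : ℕ}

/-- There is a string with handle `h`. -/
def Live (D : Collection a) (h : ℕ) : Prop := (lookup D h).isSome

def str (D : Collection a) (h : ℕ) : List (Fin a) := (lookup D h).getD []

/-- The total length of the strings. -/
def total (D : Collection a) : ℕ := (D.map fun o => (o.getD []).length).sum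

/-- The number of strings in the collection that are empty. -/
def numEmpty (D : Collection a) : ℕ := D.countP fun o => o = some []

end Collection

/-- `s[i..j]`. -/
def substring {a : ℕ} (s : List (Fin a)) (i j : ℕ) : List (Fin a) := (s.drop (i - 1)).take (j + 1 - i)

/-- `i, …, j` is a (possibly empty) range of positions of `s`. -/
def IsRange {a : ℕ} (s : List (Fin a)) (i j : ℕ) : Prop := 1 ≤ i ∧ i ≤ j + 1 ∧ j ≤ s.length

namespace Op

variable {a : ℕ}

/-- The arguments of an operation are legal. -/
def Valid (D : Collection a) : Op a → Prop
  | makeString _ => True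
  | access h i => D.Live h ∧ 1 ≤ i ∧ i ≤ (D.str h).length
  | retrieve h i j => D.Live h ∧ IsRange (D.str h) i j
  | substitute h i _ => D.Live h ∧ 1 ≤ i ∧ i ≤ (D.str h).length
  | insert h i _ => D.Live h ∧ 1 ≤ i ∧ i ≤ (D.str h).length + 1
  | delete h i => D.Live h ∧ 1 ≤ i ∧ i ≤ (D.str h).length
  | introduce h₁ i h₂ =>
    D.Live h₁ ∧ D.Live h₂ ∧ h₁ ≠ h₂ ∧ 1 ≤ i ∧ i ≤ (D.str h₁).length + 1
  | extract h i j => D.Live h ∧ IsRange (D.str h) i j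
  | equal h₁ i₁ h₂ i₂ len =>
    D.Live h₁ ∧ D.Live h₂ ∧ 1 ≤ i₁ ∧ i₁ + len ≤ (D.str h₁).length + 1 ∧
      1 ≤ i₂ ∧ i₂ + len ≤ (D.str h₂).length + 1
  | reverse h i j => D.Live h ∧ IsRange (D.str h) i j
  | map h i j => D.Live h ∧ IsRange (D.str h) i j

/-- The intended effect of an operation on a collection, and its correct answer. -/
def spec (f : Fin a → Fin a) (D : Collection a) : Op a → Collection a × Answer a
  | makeString w => (D ++ [some w], .handle D.length)
  | access h i => (D, .symbol (D.str h)[i - 1]?)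
  | retrieve h i j => (D, .string (substring (D.str h) i j))
  | substitute h i c =>
    (D.set h (some ((D.str h).take (i - 1) ++ c :: (D.str h).drop i)), .done)
  | insert h i c =>
    (D.set h (some ((D.str h).take (i - 1) ++ c :: (D.str h).drop (i - 1))), .done)
  | delete h i => (D.set h (some ((D.str h).take (i - 1) ++ (D.str h).drop i)), .done)
  | introduce h₁ i h₂ =>
    ((D.set h₁ (some ((D.str h₁).take (i - 1) ++ D.str h₂ ++ (D.str h₁).drop (i - 1)))).set h₂ none,
      .done)
  | extract h i j =>
    (D.set h (some ((D.str h).take (i - 1) ++ (D.str h).drop j)) ++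
      [some (substring (D.str h) i j)], .handle D.length)
  | equal h₁ i₁ h₂ i₂ len =>
    (D, .bool (decide (substring (D.str h₁) i₁ (i₁ + len - 1) =
      substring (D.str h₂) i₂ (i₂ + len - 1))))
  | reverse h i j =>
    (D.set h (some ((D.str h).take (i - 1) ++ (substring (D.str h) i j).reverse ++
      (D.str h).drop j)), .done)
  | map h i j =>
    (D.set h (some ((D.str h).take (i - 1) ++ (substring (D.str h) i j).map f ++
      (D.str h).drop j)), .done)

/-- `equal` is the only operation whose answer may be wrong. -/
def IsEqual : Op a → Prop
  | equal .. => True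
  | _ => False

/-- Logarithm in base 2, kept away from `0` on strings of length `0` and `1`. -/
noncomputable def lg (n : ℕ) : ℝ := Real.logb 2 (n + 2)

/-- The time bound of each operation, up to a constant factor. -/
noncomputable def bound (D : Collection a) : Op a → ℝ
  | makeString w => w.length + 1
  | access h _ => lg (D.str h).length
  | retrieve h i j => ((j + 1 - i : ℕ) : ℝ) + lg (D.str h).length
  | substitute h _ _ => lg (D.str h).length
  | insert h _ _ => lg (D.str h).length
  | delete h _ => lg (D.str h).length
  | introduce h₁ _ h₂ => lg ((D.str h₁).length + (D.str h₂).length)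
  | extract h _ _ => lg (D.str h).length
  | equal h₁ _ h₂ _ _ => lg ((D.str h₁).length + (D.str h₂).length)
  | reverse h _ _ => lg (D.str h).length
  | map h _ _ => lg (D.str h).length

end Op

/-- The collection after a sequence of operations, started from the collection `D`. -/
def collectionFrom {a : ℕ} (f : Fin a → Fin a) (D : Collection a) : List (Op a) → Collection a
  | [] => D
  | o :: ops => collectionFrom f (o.spec f D).1 ops

/-- Every operation of the sequence is legal when it is reached. -/
def ValidFrom {a : ℕ} (f : Fin a → Fin a) (D : Collection a) : List (Op a) → Prop
  | [] => True
  | o :: ops => o.Valid D ∧ ValidFrom f (o.spec f D).1 ops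

/-- The sum of the time bounds of the operations of the sequence. -/
noncomputable def boundFrom {a : ℕ} (f : Fin a → Fin a) (D : Collection a) : List (Op a) → ℝ
  | [] => 0
  | o :: ops => o.bound D + boundFrom f (o.spec f D).1 ops

/-! ### The forest -/

/-- A forest of enhanced splay trees: one root pointer per dynamic string. -/
abbrev Forest (a p : ℕ) := List (Option (Tree a p))

namespace Forest

variable {a p : ℕ}

def tree (F : Forest a p) (h : ℕ) : Tree a p := (lookup F h).getD .null

/-- The strings represented by the trees of the forest. -/
def strings (f : Fin a → Fin a) (F : Forest a p) : Collection a :=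
  F.map fun o => o.map fun t => t.str f

/-- The fields of all nodes of all trees of the forest have their intended values. -/
def WellFormed (b : ZMod p) (f : Fin a → Fin a) (F : Forest a p) : Prop :=
  ∀ h t, lookup F h = some t → t.WellFormed b f

/-- The number of machine words used: a root pointer for each string, and eleven fields (two child
pointers and the nine members of `Fields`) for each node. -/
def space (F : Forest a p) : ℕ :=
  (F.map fun o => match o with
    | none => 0
    | some t => 1 + 11 * t.count).sum

/-- Perform an operation on the forest.  Reading and updating the root pointers of the strings
involved, and reading the stored length of a given basic string, are covered by the
step that is charged here. -/
def exec (b : ZMod p) (f : Fin a → Fin a) (F : Forest a p) :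
    Op a → Timed (Forest a p × Answer a)
  | .makeString w => step do
    let t ← FeST.makeString b f w
    return (F ++ [some t], .handle F.length)
  | .access h i => step do
    let (t, c) ← FeST.access b f (F.tree h) i
    return (F.set h (some t), .symbol c)
  | .retrieve h i j => step do
    let (t, w) ← FeST.retrieve b f (F.tree h) i j
    return (F.set h (some t), .string w)
  | .substitute h i c => step do
    let t ← FeST.substitute b f (F.tree h) i c
    return (F.set h (some t), .done)
  | .insert h i c => step do
    let t ← FeST.insert b f (F.tree h) i c
    return (F.set h (some t), .done)
  | .delete h i => step do
    let t ← FeST.delete b f (F.tree h) i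
    return (F.set h (some t), .done)
  | .introduce h₁ i h₂ => step do
    let t ← FeST.introduce b f (F.tree h₁) i (F.tree h₂)
    return ((F.set h₁ (some t)).set h₂ none, .done)
  | .extract h i j => step do
    let (t, t') ← FeST.extract b f (F.tree h) i j
    return (F.set h (some t) ++ [some t'], .handle F.length)
  | .equal h₁ i₁ h₂ i₂ len => step do
    let (t₁, κ₁) ← substringFp b f (F.tree h₁) i₁ (i₁ + len - 1)
    let F₁ : Forest a p := F.set h₁ (some t₁)
    let (t₂, κ₂) ← substringFp b f (F₁.tree h₂) i₂ (i₂ + len - 1)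
    return (F₁.set h₂ (some t₂), .bool (decide (κ₁ = κ₂)))
  | .reverse h i j => step do
    let t ← FeST.reverse b f (F.tree h) i j
    return (F.set h (some t), .done)
  | .map h i j => step do
    let t ← FeST.map b f (F.tree h) i j
    return (F.set h (some t), .done)

/-- The forest after a sequence of operations, started from the forest `F`. -/
def runFrom (b : ZMod p) (f : Fin a → Fin a) (F : Forest a p) : List (Op a) → Forest a p
  | [] => F
  | o :: ops => runFrom b f (exec b f F o).val.1 ops

/-- The total time of a sequence of operations, started from the forest `F`. -/
def timeFrom (b : ZMod p) (f : Fin a → Fin a) (F : Forest a p) : List (Op a) → ℕ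
  | [] => 0
  | o :: ops => (exec b f F o).time + timeFrom b f (exec b f F o).val.1 ops

end Forest

end FeST

namespace FeST

/-! ### Running timed computations -/

section Timed

variable {α β : Type}

/-! Correctness rests on an invariant that is local to nodes. The fields of a node describe its
string before its own marks are carried out, so setting a mark breaks nothing, and pushing a mark
down only permutes the four fingerprints; for the mapping mark this uses that `f` is an involution.
A record rewritten by `mk` gets correct fields from the concatenation law `fingerprint_append_cons`.
Since a path splits the string into what lies to its left, below it and to its right, every rotation
is checked by comparing these concatenations.

For the time, the potential is the sum over all nodes of `rank n = log₂ (n + 1)`, with `n` the size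
of the subtree; null pointers have rank 0. The usual analysis of splaying works because `4 (m + 1)
(n + 1) ≤ (m + n + 2) ^ 2` (`rank_add_rank_le`): a double rotation that does not reach the root pays
for its two edges by the gain of rank. The two zigs that may replace a last zig-zig occur only once
and are covered by an additive constant (`pot_splayUp`). Descending and splaying both run over the
path, so twice the potential is used (`find_spec`).

Every substring operation is `isolate`, a change of the isolated subtree, and `plug` along at most
two edges; `isolate_plug_spec` gives all their bounds. The replacement of the last zig-zig is what
leaves the node after the substring as right child of the node before it (`splayUp_final`,
`find_final`). A perfectly balanced tree has linear potential (`build_spec`), which pays for new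
strings. Summation telescopes in `runFrom_spec`.

For equality, two different strings of equal length `ℓ` give different polynomials of degree below
`ℓ`, so fewer than `ℓ` bases make their fingerprints collide (`card_collisions_lt`). With `ℓ ≤ N`
and `N ^ (c + 1) ≤ p`, a random base is bad with probability at most `(N - 1) / (p - 1) ≤ 1 / N ^
c`. -/

@[simp] theorem Timed.val_bind (x : Timed α) (g : α → Timed β) :
    (x >>= g).val = (g x.val).val := rfl

@[simp] theorem Timed.time_bind (x : Timed α) (g : α → Timed β) :
    (x >>= g).time = x.time + (g x.val).time := rfl

@[simp] theorem Timed.val_pure (x : α) : (pure x : Timed α).val = x := rfl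

@[simp] theorem Timed.time_pure (x : α) : (pure x : Timed α).time = 0 := rfl

@[simp] theorem val_tick (x : α) : (tick x).val = x := rfl

@[simp] theorem val_step (x : Timed α) : (step x).val = x.val := rfl

@[simp] theorem time_step (x : Timed α) : (step x).time = x.time + 1 := rfl

end Timed

/-! ### Fingerprints of concatenations -/

section Fingerprint

variable {a p : ℕ} (b : ZMod p)

@[simp] theorem fingerprint_nil : fingerprint b ([] : List (Fin a)) = 0 := by
  simp [fingerprint]

theorem fingerprint_cons (c : Fin a) (s : List (Fin a)) :
    fingerprint b (c :: s) = code p c * b ^ s.length + fingerprint b s := by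
  unfold fingerprint
  change ∑ i : Fin (s.length + 1), code p ((c :: s).get i.rev) * b ^ (i : ℕ) = _
  -- The top index belongs to the head of the list, since `Fin.rev` sends the last index to 0.
  rw [Fin.sum_univ_castSucc, add_comm]
  congr 1
  · simp
  · refine Finset.sum_congr rfl fun i _ => ?_
    rw [Fin.rev_castSucc]
    rfl

theorem fingerprint_append (s t : List (Fin a)) :
    fingerprint b (s ++ t) = fingerprint b s * b ^ t.length + fingerprint b t := by
  induction s with
  | nil => simp
  | cons c s ih =>
    rw [List.cons_append, fingerprint_cons, fingerprint_cons, ih, List.length_append, pow_add]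
    ring

theorem fingerprint_append_cons (s t : List (Fin a)) (c : Fin a) :
    fingerprint b (s ++ c :: t) =
      (fingerprint b s * b + code p c) * b ^ t.length + fingerprint b t := by
  rw [fingerprint_append, fingerprint_cons, List.length_cons, pow_succ]
  ring

end Fingerprint

/-! ### Ranks and the potential -/

/-- The rank of a tree with `n` nodes. -/
noncomputable def rank (n : ℕ) : ℝ := Real.logb 2 (n + 1)

theorem rank_nonneg (n : ℕ) : 0 ≤ rank n :=
  Real.logb_nonneg one_lt_two (by simp)

theorem rank_mono {m n : ℕ} (h : m ≤ n) : rank m ≤ rank n :=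
  Real.logb_le_logb_of_le one_lt_two (by positivity) (by gcongr)

/-- By the inequality between arithmetic and geometric means, two disjoint subtrees inside a larger
one cannot both have almost its rank. The 2 pays for the two edges of a double rotation. -/
theorem rank_add_rank_le {m n k : ℕ} (h : m + n + 1 ≤ k) : rank m + rank n + 2 ≤ 2 * rank k := by
  have h4 : (2 : ℝ) = Real.logb 2 4 := by
    rw [show (4 : ℝ) = 2 ^ (2 : ℝ) by norm_num, Real.logb_rpow] <;> norm_num
  have hk : 2 * rank k = Real.logb 2 (((k : ℝ) + 1) ^ 2) := by
    rw [Real.logb_pow]; rfl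
  rw [hk]
  unfold rank
  have h5 : ∀ x : ℝ, x + 2 = x + Real.logb 2 4 := fun x => by rw [← h4]
  rw [h5, ← Real.logb_mul (by positivity) (by positivity), ← Real.logb_mul (by positivity) (by norm_num)]
  refine Real.logb_le_logb_of_le one_lt_two (by positivity) ?_
  have h' : (m : ℝ) + n + 1 ≤ k := by exact_mod_cast h
  have hm : (0 : ℝ) ≤ m := by positivity
  have hn : (0 : ℝ) ≤ n := by positivity
  nlinarith [sq_nonneg ((m : ℝ) - n)]

theorem rank_le_lg (n : ℕ) : rank n ≤ Op.lg n :=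
  Real.logb_le_logb_of_le one_lt_two (by positivity) (by linarith)

theorem rank_succ (n : ℕ) : rank (n + 1) = Op.lg n := by
  unfold rank Op.lg
  push_cast
  ring_nf

theorem lg_mono {m n : ℕ} (h : m ≤ n) : Op.lg m ≤ Op.lg n :=
  Real.logb_le_logb_of_le one_lt_two (by positivity) (by gcongr)

theorem one_le_lg (n : ℕ) : 1 ≤ Op.lg n := by
  rw [Op.lg, Real.le_logb_iff_rpow_le one_lt_two (by positivity)]
  simp

namespace Tree

variable {a p : ℕ}

/-- The sum of the ranks of all subtrees. -/
noncomputable def pot : Tree a p → ℝ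
  | null => 0
  | node l _ r => l.pot + r.pot + rank (l.count + 1 + r.count)

theorem pot_toggleRev (t : Tree a p) : t.toggleRev.pot = t.pot := by
  cases t <;> simp [toggleRev, pot]

theorem pot_toggleMap (t : Tree a p) : t.toggleMap.pot = t.pot := by
  cases t <;> simp [toggleMap, pot]

theorem pot_fix (t : Tree a p) : t.fix.pot = t.pot := by
  cases t with
  | null => rfl
  | node l x r =>
    simp only [fix]
    split
    · simp only [pot, pot_toggleRev, count_toggleRev]
      rw [show r.count + 1 + l.count = l.count + 1 + r.count by omega]
      ring
    · rfl

theorem pot_fixm (f : Fin a → Fin a) (t : Tree a p) : (t.fixm f).pot = t.pot := by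
  cases t with
  | null => rfl
  | node l x r =>
    simp only [fixm]
    split
    · simp only [pot, pot_toggleMap, count_toggleMap]
    · rfl

theorem pot_visit (f : Fin a → Fin a) (t : Tree a p) : (t.visit f).pot = t.pot := by
  rw [visit, pot_fixm, pot_fix]

/-! ### Marks do not change the represented string -/

variable {f : Fin a → Fin a}

theorem length_str (t : Tree a p) : (t.str f).length = t.count := by
  induction t with
  | null => rfl
  | node l x r hl hr =>
    simp only [str, count]
    split <;> split <;> simp [hl, hr] <;> omega

theorem str_toggleRev (t : Tree a p) : t.toggleRev.str f = (t.str f).reverse := by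
  cases t with
  | null => rfl
  | node l x r => cases h₁ : x.rev <;> cases h₂ : x.map <;> simp [toggleRev, str, h₁, h₂]

theorem str_toggleMap (hf : Function.Involutive f) (t : Tree a p) :
    t.toggleMap.str f = (t.str f).map f := by
  cases t with
  | null => rfl
  | node l x r =>
    cases h₁ : x.rev <;> cases h₂ : x.map <;> simp [toggleMap, str, h₁, h₂, hf.comp_self, hf x.char]

theorem str_fix (t : Tree a p) : t.fix.str f = t.str f := by
  cases t with
  | null => rfl
  | node l x r =>
    cases h₁ : x.rev <;> cases h₂ : x.map <;> simp [fix, str, h₁, h₂, str_toggleRev]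

theorem str_fixm (hf : Function.Involutive f) (t : Tree a p) : (t.fixm f).str f = t.str f := by
  cases t with
  | null => rfl
  | node l x r =>
    cases h₁ : x.rev <;> cases h₂ : x.map <;> simp [fixm, str, h₁, h₂, str_toggleMap hf]

theorem str_visit (hf : Function.Involutive f) (t : Tree a p) : (t.visit f).str f = t.str f := by
  rw [visit, str_fixm hf, str_fix]

/-- The conditions on a node concern its string before its own marks act, so flipping a mark affects
none of them. -/
theorem WellFormed.toggleRev {b : ZMod p} {t : Tree a p} (h : t.WellFormed b f) :
    t.toggleRev.WellFormed b f := by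
  cases t <;> exact h

theorem WellFormed.toggleMap {b : ZMod p} {t : Tree a p} (h : t.WellFormed b f) :
    t.toggleMap.WellFormed b f := by
  cases t <;> exact h

theorem WellFormed.fix {b : ZMod p} {t : Tree a p} (h : t.WellFormed b f) :
    t.fix.WellFormed b f := by
  cases t with
  | null => trivial
  | node l x r =>
    simp only [Tree.fix]
    split
    · obtain ⟨hl, hr, h₁, h₂, h₃, h₄, h₅, h₆⟩ := h
      refine ⟨hr.toggleRev, hl.toggleRev, ?_, ?_, ?_, ?_, ?_, ?_⟩ <;>
        simp only [str_toggleRev, *] <;> simp [Nat.add_comm, Nat.add_left_comm, Nat.add_assoc]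
    · exact h

/-- After the marks are pushed, the node stands for `f(u)`, so its fingerprint for the mapped string
must be that of `f(f(u)) = u`: exchanging the plain and mapped values is right because `f` is an
involution. -/
theorem WellFormed.fixm (hf : Function.Involutive f) {b : ZMod p} {t : Tree a p}
    (h : t.WellFormed b f) : (t.fixm f).WellFormed b f := by
  cases t with
  | null => trivial
  | node l x r =>
    simp only [Tree.fixm]
    split
    · obtain ⟨hl, hr, h₁, h₂, h₃, h₄, h₅, h₆⟩ := h
      refine ⟨hl.toggleMap, hr.toggleMap, ?_, ?_, ?_, ?_, ?_, ?_⟩ <;>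
        simp only [str_toggleMap hf, *] <;> simp [hf.comp_self, hf _]
    · exact h

theorem WellFormed.visit (hf : Function.Involutive f) {b : ZMod p} {t : Tree a p}
    (h : t.WellFormed b f) : (t.visit f).WellFormed b f :=
  h.fix.fixm hf

/-- Length is blind to both marks, so sizes and powers may be read without visiting the node.
Fingerprints may not, hence the assumption `Clean` in the lemmas on them. -/
theorem WellFormed.size_eq {b : ZMod p} {t : Tree a p} (h : t.WellFormed b f) :
    t.size = t.count := by
  cases t with
  | null => rfl
  | node l x r =>
    rw [size, h.2.2.1]
    simp [length_str, count, Nat.add_assoc, Nat.add_comm, Nat.add_left_comm]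

theorem WellFormed.power_eq {b : ZMod p} {t : Tree a p} (h : t.WellFormed b f) :
    t.power = b ^ t.count := by
  cases t with
  | null => simp [power, count]
  | node l x r =>
    rw [power, h.2.2.2.1]
    simp [length_str, count, Nat.add_assoc, Nat.add_comm, Nat.add_left_comm]

/-- There are no marks at the root. -/
def Clean : Tree a p → Prop
  | null => True
  | node _ x _ => x.rev = false ∧ x.map = false

theorem clean_visit (t : Tree a p) : (t.visit f).Clean := by
  cases t with
  | null => trivial
  | node l x r => cases h₁ : x.rev <;> cases h₂ : x.map <;> simp [visit, fix, fixm, h₁, h₂, Clean]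

theorem Clean.visit_eq {t : Tree a p} (h : t.Clean) : t.visit f = t := by
  cases t with
  | null => rfl
  | node l x r => simp [visit, fix, fixm, h.1, h.2]

theorem Clean.str_node {l r : Tree a p} {x : Fields a p} (h : (node l x r).Clean) :
    (node l x r).str f = l.str f ++ x.char :: r.str f := by
  simp [str, h.1, h.2]

theorem WellFormed.fp_eq {b : ZMod p} {t : Tree a p} (h : t.WellFormed b f) (hc : t.Clean) :
    t.fp = fingerprint b (t.str f) := by
  cases t with
  | null => simp [fp, str]
  | node l x r => rw [fp, h.2.2.2.2.1, hc.str_node]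

theorem WellFormed.fprev_eq {b : ZMod p} {t : Tree a p} (h : t.WellFormed b f) (hc : t.Clean) :
    t.fprev = fingerprint b (t.str f).reverse := by
  cases t with
  | null => simp [fprev, str]
  | node l x r => rw [fprev, h.2.2.2.2.2.1, hc.str_node]

theorem WellFormed.mfp_eq {b : ZMod p} {t : Tree a p} (h : t.WellFormed b f) (hc : t.Clean) :
    t.mfp = fingerprint b ((t.str f).map f) := by
  cases t with
  | null => simp [mfp, str]
  | node l x r => rw [mfp, h.2.2.2.2.2.2.1, hc.str_node]

theorem WellFormed.mfprev_eq {b : ZMod p} {t : Tree a p} (h : t.WellFormed b f) (hc : t.Clean) :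
    t.mfprev = fingerprint b ((t.str f).map f).reverse := by
  cases t with
  | null => simp [mfprev, str]
  | node l x r => rw [mfprev, h.2.2.2.2.2.2.2, hc.str_node]

/-- The data of a visited node: an unmarked node with the same string, size and potential. -/
theorem visit_eq_node (hf : Function.Involutive f) {b : ZMod p} {t l r : Tree a p}
    {x : Fields a p} (h : t.visit f = node l x r) (ht : t.WellFormed b f) :
    (node l x r).Clean ∧ (node l x r).WellFormed b f ∧ t.str f = l.str f ++ x.char :: r.str f ∧
      t.count = l.count + 1 + r.count ∧
      t.pot = l.pot + r.pot + rank (l.count + 1 + r.count) := by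
  have hc : (node l x r).Clean := h ▸ clean_visit t
  refine ⟨hc, h ▸ ht.visit hf, ?_, ?_, ?_⟩
  · rw [← str_visit hf, h, hc.str_node]
  · rw [← count_visit f, h, count]
  · rw [← pot_visit f, h, pot]

theorem visit_eq_null {t : Tree a p} (h : t.visit f = null) : t = null := by
  have : t.count = 0 := by rw [← count_visit f, h, count]
  cases t with
  | null => rfl
  | node l x r => simp only [count] at this; omega

end Tree

/-! ### Rewriting a node -/

section mk

variable {a p : ℕ} (b : ZMod p) (f : Fin a → Fin a) (l r : Tree a p) (c : Fin a)

theorem mk_val : ∃ x : Fields a p, x.char = c ∧ x.rev = false ∧ x.map = false ∧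
    (mk b f l c r).val = .node (l.visit f) x (r.visit f) :=
  ⟨_, rfl, rfl, rfl, rfl⟩

@[simp] theorem time_mk : (mk b f l c r).time = 1 := rfl

@[simp] theorem count_mk : (mk b f l c r).val.count = l.count + 1 + r.count := by
  obtain ⟨x, -, -, -, h⟩ := mk_val b f l r c
  simp [h, Tree.count, Tree.count_visit]

@[simp] theorem pot_mk :
    (mk b f l c r).val.pot = l.pot + r.pot + rank (l.count + 1 + r.count) := by
  obtain ⟨x, -, -, -, h⟩ := mk_val b f l r c
  simp [h, Tree.pot, Tree.count_visit, Tree.pot_visit]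

variable {b f l r}

theorem str_mk (hf : Function.Involutive f) :
    (mk b f l c r).val.str f = l.str f ++ c :: r.str f := by
  obtain ⟨x, h₁, h₂, h₃, h⟩ := mk_val b f l r c
  simp [h, Tree.str, h₁, h₂, h₃, Tree.str_visit hf]

/-- Each of the four formulas in `mk` is `fingerprint_append_cons` for one of the four variants of
the string; in the reversed variants the children trade places. The children are visited first, so
their stored fingerprints are those of the strings they represent. -/
theorem wellFormed_mk (hf : Function.Involutive f) (hl : l.WellFormed b f)
    (hr : r.WellFormed b f) : (mk b f l c r).val.WellFormed b f := by
  have hl' := hl.visit hf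
  have hr' := hr.visit hf
  have cl := Tree.clean_visit (f := f) l
  have cr := Tree.clean_visit (f := f) r
  refine ⟨hl', hr', ?_, ?_, ?_, ?_, ?_, ?_⟩ <;>
    simp only [hl'.size_eq, hr'.size_eq, hl'.power_eq, hr'.power_eq, hl'.fp_eq cl, hr'.fp_eq cr,
      hl'.fprev_eq cl, hr'.fprev_eq cr, hl'.mfp_eq cl, hr'.mfp_eq cr, hl'.mfprev_eq cl,
      hr'.mfprev_eq cr, List.map_append, List.map_cons, List.reverse_append, List.reverse_cons,
      List.append_assoc, List.singleton_append, List.length_append, List.length_cons,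
      fingerprint_append_cons, Tree.length_str, List.length_reverse, List.length_map]
  · omega
  · ring

end mk

/-! ### Paths -/

section Paths

variable {a p : ℕ}

/-- The subtree hanging off an edge of a path. -/
def Frame.side : Frame a p → Tree a p
  | left _ r => r
  | right l _ => l

/-- The part of the string to the left of the lower end of a path. -/
def pathPre (f : Fin a → Fin a) : List (Frame a p) → List (Fin a)
  | [] => []
  | .left _ _ :: path => pathPre f path
  | .right l c :: path => pathPre f path ++ (l.str f ++ [c])

/-- The part of the string to the right of the lower end of a path. -/
def pathPost (f : Fin a → Fin a) : List (Frame a p) → List (Fin a)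
  | [] => []
  | .left c r :: path => c :: r.str f ++ pathPost f path
  | .right _ _ :: path => pathPost f path

/-- The number of nodes outside the subtree at the lower end of a path. -/
def pathCount : List (Frame a p) → ℕ
  | [] => 0
  | e :: path => e.side.count + 1 + pathCount path

/-- The potential of everything outside the subtree at the lower end of a path, which has `n`
nodes. -/
noncomputable def pathPot : List (Frame a p) → ℕ → ℝ
  | [], _ => 0
  | e :: path, n =>
    e.side.pot + rank (n + 1 + e.side.count) + pathPot path (n + 1 + e.side.count)

/-- The potential of the subtrees hanging off a path. -/
noncomputable def sidePot : List (Frame a p) → ℝ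
  | [] => 0
  | e :: path => e.side.pot + sidePot path

def PathWellFormed (b : ZMod p) (f : Fin a → Fin a) (path : List (Frame a p)) : Prop :=
  ∀ e ∈ path, e.side.WellFormed b f

theorem pathPre_append (f : Fin a → Fin a) (q path : List (Frame a p)) :
    pathPre f (q ++ path) = pathPre f path ++ pathPre f q := by
  induction q with
  | nil => simp [pathPre]
  | cons e q ih => cases e <;> simp [pathPre, ih]

theorem pathPost_append (f : Fin a → Fin a) (q path : List (Frame a p)) :
    pathPost f (q ++ path) = pathPost f q ++ pathPost f path := by
  induction q with
  | nil => simp [pathPost]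
  | cons e q ih => cases e <;> simp [pathPost, ih]

theorem pathCount_append (q path : List (Frame a p)) :
    pathCount (q ++ path) = pathCount q + pathCount path := by
  induction q with
  | nil => simp [pathCount]
  | cons e q ih => simp [pathCount, ih, Nat.add_assoc]

theorem pathPot_append (q path : List (Frame a p)) (n : ℕ) :
    pathPot (q ++ path) n = pathPot q n + pathPot path (n + pathCount q) := by
  induction q generalizing n with
  | nil => simp [pathPot, pathCount]
  | cons e q ih =>
    simp only [List.cons_append, pathPot, ih, pathCount]
    rw [show n + 1 + e.side.count + pathCount q = n + (e.side.count + 1 + pathCount q) by omega]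
    ring

theorem pathWellFormed_nil {b : ZMod p} {f : Fin a → Fin a} :
    PathWellFormed b f ([] : List (Frame a p)) := by
  simp [PathWellFormed]

theorem pathWellFormed_cons {b : ZMod p} {f : Fin a → Fin a} {e : Frame a p}
    {path : List (Frame a p)} :
    PathWellFormed b f (e :: path) ↔ e.side.WellFormed b f ∧ PathWellFormed b f path := by
  simp [PathWellFormed]

theorem PathWellFormed.append {b : ZMod p} {f : Fin a → Fin a} {q path : List (Frame a p)}
    (hq : PathWellFormed b f q) (hp : PathWellFormed b f path) :
    PathWellFormed b f (q ++ path) := by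
  intro e he
  rcases List.mem_append.1 he with he | he
  exacts [hq e he, hp e he]

end Paths

/-! ### Descending and splaying -/

section Splay

variable {a p : ℕ} {b : ZMod p} {f : Fin a → Fin a}

/-- The starting path is arbitrary and only the new part `q` is described, so that the induction
passes to a child, and so that a descent can be resumed below a known edge. -/
theorem descend_spec (hf : Function.Involutive f) (t : Tree a p) (i : ℕ)
    (path : List (Frame a p)) (ht : t.WellFormed b f) (hi : 1 ≤ i) (hi' : i ≤ t.count) :
    ∃ q l c r, (descend f t i path).val = some (q ++ path, l, c, r) ∧
      (descend f t i path).time = q.length + 1 ∧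
      t.str f = pathPre f q ++ l.str f ++ c :: (r.str f ++ pathPost f q) ∧
      (pathPre f q ++ l.str f).length + 1 = i ∧
      PathWellFormed b f q ∧ l.WellFormed b f ∧ r.WellFormed b f ∧
      t.count = l.count + 1 + r.count + pathCount q ∧
      t.pot = l.pot + r.pot + rank (l.count + 1 + r.count) +
        pathPot q (l.count + 1 + r.count) := by
  induction hn : t.count using Nat.strong_induction_on generalizing t i path with
  | _ n ih =>
  subst hn
  rw [descend]
  split
  · rename_i h
    rw [Tree.visit_eq_null h] at hi'
    simp only [Tree.count] at hi'
    omega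
  · rename_i l x r h
    obtain ⟨-, hw, hs, hc, hp⟩ := Tree.visit_eq_node hf h ht
    obtain ⟨hl, hr, -⟩ := hw
    have hsz := hl.size_eq
    split_ifs with h₁ h₂
    · refine ⟨[], l, x.char, r, rfl, rfl, ?_, ?_, ?_, hl, hr, ?_, ?_⟩
      · simpa [pathPre, pathPost] using hs
      · simp [pathPre, Tree.length_str, h₁, hsz]
      · intro e he; simp at he
      · simp [pathCount, hc]
      · simp [pathPot, hp]
    · obtain ⟨q, l', c', r', e₁, e₂, e₃, e₄, e₅, e₆, e₇, e₈, e₉⟩ :=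
        ih l.count (by omega) l i (.left x.char r :: path) hl hi (by omega) rfl
      refine ⟨q ++ [.left x.char r], l', c', r', ?_, ?_, ?_, ?_, ?_, e₆, e₇, ?_, ?_⟩
      · simp [e₁]
      · simp [e₂]
      · simp [hs, e₃, pathPre_append, pathPost_append, pathPre, pathPost]
      · rw [pathPre_append, ← e₄]; rfl
      · refine e₅.append fun e he => ?_
        rw [List.mem_singleton.1 he]; exact hr
      · rw [pathCount_append]
        simp only [pathCount, Frame.side]
        omega
      · rw [hp, e₉, pathPot_append]
        simp only [pathPot, Frame.side]
        rw [← e₈]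
        ring
    · obtain ⟨q, l', c', r', e₁, e₂, e₃, e₄, e₅, e₆, e₇, e₈, e₉⟩ :=
        ih r.count (by omega) r (i - (l.size + 1)) (.right l x.char :: path) hr (by omega)
          (by omega) rfl
      refine ⟨q ++ [.right l x.char], l', c', r', ?_, ?_, ?_, ?_, ?_, e₆, e₇, ?_, ?_⟩
      · simp [e₁]
      · simp [e₂]
      · simp [hs, e₃, pathPre_append, pathPost_append, pathPre, pathPost]
      · rw [pathPre_append]
        simp only [pathPre, List.length_append, List.length_cons, List.length_nil,
          Tree.length_str] at e₄ ⊢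
        omega
      · refine e₅.append fun e he => ?_
        rw [List.mem_singleton.1 he]; exact hl
      · rw [pathCount_append]
        simp only [pathCount, Frame.side]
        omega
      · rw [hp, e₉, pathPot_append]
        simp only [pathPot, Frame.side]
        rw [← e₈, show r.count + 1 + l.count = l.count + 1 + r.count by omega]
        ring

theorem time_splayUp (final : Bool) (path : List (Frame a p)) (A B : Tree a p) :
    (splayUp b f final path A B).time = path.length := by
  fun_induction splayUp b f final path A B <;> simp_all <;> omega

theorem str_splayUp (hf : Function.Involutive f) (final : Bool) (path : List (Frame a p))
    (A B : Tree a p) :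
    (splayUp b f final path A B).val.1.str f = pathPre f path ++ A.str f ∧
      (splayUp b f final path A B).val.2.str f = B.str f ++ pathPost f path := by
  fun_induction splayUp b f final path A B <;>
    simp_all [pathPre, pathPost, str_mk _ hf]

theorem wellFormed_splayUp (hf : Function.Involutive f) (final : Bool) (path : List (Frame a p))
    (A B : Tree a p) (hp : PathWellFormed b f path) (hA : A.WellFormed b f)
    (hB : B.WellFormed b f) :
    (splayUp b f final path A B).val.1.WellFormed b f ∧
      (splayUp b f final path A B).val.2.WellFormed b f := by
  fun_induction splayUp b f final path A B
  all_goals try simp only [pathWellFormed_cons, Frame.side] at hp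
  case case5 ih => exact ih _ hp.2.2 hA (wellFormed_mk _ hf hB (wellFormed_mk _ hf hp.1 hp.2.1))
  case case7 ih => exact ih _ hp.2.2 (wellFormed_mk _ hf (wellFormed_mk _ hf hp.2.1 hp.1) hA) hB
  all_goals simp_all [wellFormed_mk _ hf]

theorem count_splayUp (final : Bool) (path : List (Frame a p)) (A B : Tree a p) :
    (splayUp b f final path A B).val.1.count + (splayUp b f final path A B).val.2.count =
      A.count + B.count + pathCount path := by
  fun_induction splayUp b f final path A B <;>
    simp_all [pathCount, Frame.side] <;> omega

/-- The rank of the splayed node is left out on both sides, so the classical bound `3 (r' - r)` on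
the amortized cost appears as `2 (r' - r)`. The final constant pays for the at most two edges of
single rotations at the root. -/
theorem pot_splayUp (final : Bool) (path : List (Frame a p)) (A B : Tree a p) :
    path.length + (splayUp b f final path A B).val.1.pot +
        (splayUp b f final path A B).val.2.pot ≤
      A.pot + B.pot + pathPot path (A.count + 1 + B.count) +
        2 * (rank (A.count + B.count + 1 + pathCount path) - rank (A.count + 1 + B.count)) +
        2 := by
  fun_induction splayUp b f final path A B
  all_goals simp_all [pathCount, pathPot, Frame.side]
  case case1 A B =>
    have h₁ := rank_mono (show A.count + 1 + B.count ≤ A.count + B.count + 1 by omega)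
    linarith
  case case2 y C A B =>
    have h₁ := rank_mono (show B.count + 1 + C.count ≤ A.count + 1 + B.count + 1 + C.count by omega)
    have h₂ := rank_mono
      (show A.count + 1 + B.count ≤ A.count + B.count + 1 + (C.count + 1) by omega)
    linarith
  case case3 C y A B =>
    have h₁ := rank_mono (show C.count + 1 + A.count ≤ A.count + 1 + B.count + 1 + C.count by omega)
    have h₂ := rank_mono
      (show A.count + 1 + B.count ≤ A.count + B.count + 1 + (C.count + 1) by omega)
    linarith
  -- Two zigs at the root: the two edges are paid by the additive 2, and the ranks grow by at most
  -- the difference between the root and the splayed node.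
  case case4 y C z D path A B h =>
    have h₁ := rank_mono (show A.count + 1 + B.count ≤ A.count + 1 + B.count + 1 + C.count by omega)
    have h₂ := rank_mono (show B.count + 1 + C.count ≤
      A.count + B.count + 1 + (C.count + 1 + (D.count + 1)) by omega)
    have h₃ := rank_mono (show B.count + 1 + C.count + 1 + D.count ≤
      A.count + 1 + B.count + 1 + C.count + 1 + D.count by omega)
    have h₄ := rank_mono (show A.count + 1 + B.count ≤
      A.count + B.count + 1 + (C.count + 1 + (D.count + 1)) by omega)
    linarith
  case case6 C y D z path A B h =>
    have h₁ := rank_mono (show A.count + 1 + B.count ≤ A.count + 1 + B.count + 1 + C.count by omega)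
    have h₂ := rank_mono (show C.count + 1 + A.count ≤
      A.count + B.count + 1 + (C.count + 1 + (D.count + 1)) by omega)
    have h₃ := rank_mono (show D.count + 1 + (C.count + 1 + A.count) ≤
      A.count + 1 + B.count + 1 + C.count + 1 + D.count by omega)
    have h₄ := rank_mono (show A.count + 1 + B.count ≤
      A.count + B.count + 1 + (C.count + 1 + (D.count + 1)) by omega)
    linarith
  case case5 y C z D path A B h ih =>
    have h₁ := rank_mono (show A.count + 1 + B.count ≤ A.count + 1 + B.count + 1 + C.count by omega)
    have h₂ := rank_mono (show B.count + 1 + (C.count + 1 + D.count) ≤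
      A.count + 1 + B.count + 1 + C.count + 1 + D.count by omega)
    -- The old subtree of the splayed node and the new subtree of its grandparent are disjoint, and
    -- the parent is in neither.
    have h₃ := rank_add_rank_le (show (A.count + 1 + B.count) + (C.count + 1 + D.count) + 1 ≤
      A.count + 1 + B.count + 1 + C.count + 1 + D.count by omega)
    have ih := ih (mk b f B y (mk b f C z D).val).val
    simp only [count_mk, pot_mk] at ih
    simp only [Nat.add_assoc, Nat.add_comm, Nat.add_left_comm] at *
    linarith
  case case7 C y D z path A B h ih =>
    have h₁ := rank_mono (show A.count + 1 + B.count ≤ A.count + 1 + B.count + 1 + C.count by omega)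
    have h₂ := rank_mono (show (D.count + 1 + C.count) + 1 + A.count ≤
      A.count + 1 + B.count + 1 + C.count + 1 + D.count by omega)
    have h₃ := rank_add_rank_le (show (A.count + 1 + B.count) + (D.count + 1 + C.count) + 1 ≤
      A.count + 1 + B.count + 1 + C.count + 1 + D.count by omega)
    have ih := ih (mk b f (mk b f D z C).val y A).val
    simp only [count_mk, pot_mk] at ih
    simp only [Nat.add_assoc, Nat.add_comm, Nat.add_left_comm] at *
    linarith
  case case8 C y z D path A B ih =>
    have h₁ := rank_mono (show A.count + 1 + B.count ≤ A.count + 1 + B.count + 1 + C.count by omega)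
    have h₂ := rank_mono (show A.count + 1 + B.count ≤
      A.count + 1 + B.count + 1 + C.count + 1 + D.count by omega)
    -- In a zig-zag the disjoint subtrees are those of the former parent and grandparent, now the
    -- two children of the splayed node.
    have h₃ := rank_add_rank_le (show (C.count + 1 + A.count) + (B.count + 1 + D.count) + 1 ≤
      A.count + 1 + B.count + 1 + C.count + 1 + D.count by omega)
    have ih := ih (mk b f C y A).val (mk b f B z D).val
    simp only [count_mk, pot_mk] at ih
    simp only [Nat.add_assoc, Nat.add_comm, Nat.add_left_comm] at *
    linarith
  case case9 y C D z path A B ih =>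
    have h₁ := rank_mono (show A.count + 1 + B.count ≤ A.count + 1 + B.count + 1 + C.count by omega)
    have h₂ := rank_mono (show A.count + 1 + B.count ≤
      A.count + 1 + B.count + 1 + C.count + 1 + D.count by omega)
    have h₃ := rank_add_rank_le (show (D.count + 1 + A.count) + (B.count + 1 + C.count) + 1 ≤
      A.count + 1 + B.count + 1 + C.count + 1 + D.count by omega)
    have ih := ih (mk b f D z A).val (mk b f B y C).val
    simp only [count_mk, pot_mk] at ih
    simp only [Nat.add_assoc, Nat.add_comm, Nat.add_left_comm] at *
    linarith

/-- If a node is splayed with `final` in the left subtree of the root, then the old root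
becomes its right child and keeps its right subtree. -/
theorem splayUp_final (hf : Function.Involutive f) (path : List (Frame a p)) (z : Fin a)
    (D A B : Tree a p) :
    ∃ x : Fields a p, ∃ B' D' : Tree a p, x.char = z ∧ x.rev = false ∧ x.map = false ∧
      (splayUp b f true (path ++ [.left z D]) A B).val.2 = .node B' x D' ∧
      D'.str f = D.str f := by
  induction hn : path.length using Nat.strong_induction_on generalizing path A B with
  | _ n ih =>
  subst hn
  rcases path with _ | ⟨e₁, _ | ⟨e₂, path⟩⟩
  · exact ⟨_, _, _, rfl, rfl, rfl, rfl, Tree.str_visit hf D⟩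
  · cases e₁ <;> exact ⟨_, _, _, rfl, rfl, rfl, rfl, Tree.str_visit hf D⟩
  -- The edge to the root is still ahead, so this double rotation is an ordinary one and the
  -- induction continues two edges higher.
  · have h : (path ++ [Frame.left z D]).isEmpty = false := by simp
    cases e₁ <;> cases e₂ <;> 
    · simp only [List.cons_append, splayUp, h, Bool.and_false, Bool.false_eq_true, if_false]
      exact ih path.length (by simp) path _ _ rfl

end Splay
-- Splaying a position, isolating a substring and reattaching a subtree
section Isolate

variable {a p : ℕ} {b : ZMod p} {f : Fin a → Fin a}

/-- For a path of `k` edges the time is `2k + 2`: `k + 1` for the descent, `k` for the rotations and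
1 for the new root. Doubling `pot_splayUp` pays for `2k` and gives `4 rank + 4`; the rank of the new
root adds `2 rank`, and the remaining 2 steps make the constant 6. -/
theorem find_spec (hf : Function.Involutive f) (final : Bool) {t : Tree a p} {i : ℕ}
    (ht : t.WellFormed b f) (hi : 1 ≤ i) (hi' : i ≤ t.count) :
    ∃ l x r, (find b f final t i).val = .node l x r ∧ (Tree.node l x r).Clean ∧
      (Tree.node l x r).WellFormed b f ∧ t.str f = l.str f ++ x.char :: r.str f ∧
      l.count + 1 = i ∧ t.count = l.count + 1 + r.count ∧
      (find b f final t i).time + 2 * (l.pot + r.pot + rank t.count) ≤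
        2 * t.pot + 6 * rank t.count + 6 := by
  obtain ⟨q, l, c, r, e₁, e₂, e₃, e₄, e₅, e₆, e₇, e₈, e₉⟩ := descend_spec hf t i [] ht hi hi'
  rw [List.append_nil] at e₁
  obtain ⟨s₁, s₂⟩ := str_splayUp (b := b) hf final q l r
  obtain ⟨w₁, w₂⟩ := wellFormed_splayUp hf final q l r e₅ e₆ e₇
  have hc := count_splayUp (b := b) (f := f) final q l r
  have hp := pot_splayUp (b := b) (f := f) final q l r
  have ht := time_splayUp (b := b) (f := f) final q l r
  have hL : ((splayUp b f final q l r).val.1.visit f).str f = pathPre f q ++ l.str f := by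
    rw [Tree.str_visit hf, s₁]
  have hv : (find b f final t i).val =
      (mk b f (splayUp b f final q l r).val.1 c (splayUp b f final q l r).val.2).val := by
    simp [find, e₁]
  have hm : (find b f final t i).time = 2 * q.length + 2 := by
    simp [find, e₁, e₂, ht]; omega
  obtain ⟨x, x₁, x₂, x₃, hx⟩ :=
    mk_val b f (splayUp b f final q l r).val.1 (splayUp b f final q l r).val.2 c
  refine ⟨_, x, _, hv.trans hx, ⟨x₂, x₃⟩, hx ▸ wellFormed_mk c hf w₁ w₂, ?_, ?_, ?_, ?_⟩
  · rw [Tree.str_visit hf, Tree.str_visit hf, s₁, s₂, e₃, x₁]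
  · rw [← Tree.length_str (f := f), hL, e₄]
  · rw [Tree.count_visit, Tree.count_visit]; omega
  · rw [Tree.pot_visit, Tree.pot_visit, hm, e₉]
    have e : l.count + r.count + 1 + pathCount q = t.count := by omega
    rw [e] at hp
    have := rank_nonneg (l.count + 1 + r.count)
    push_cast
    linarith

/-- If the root is unmarked and a node of its left subtree is splayed with `final`, then the old
root becomes the right child of the new root and keeps its right subtree. -/
theorem find_final (hf : Function.Involutive f) {l r : Tree a p} {x : Fields a p} {i : ℕ}
    (hc : (Tree.node l x r).Clean) (ht : (Tree.node l x r).WellFormed b f) (hi : 1 ≤ i)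
    (hi' : i ≤ l.count) {l' r' : Tree a p} {x' : Fields a p}
    (h : (find b f true (.node l x r) i).val = .node l' x' r') :
    ∃ B y D, r'.visit f = .node B y D ∧ y.char = x.char ∧ D.str f = r.str f := by
  have hl := ht.1
  have hs := hl.size_eq
  obtain ⟨q, A, c, B, e₁, -⟩ := descend_spec hf l i [Frame.left x.char r] hl hi hi'
  have e : (descend f (.node l x r) i []).val = some (q ++ [Frame.left x.char r], A, c, B) := by
    -- The root is unmarked, so visiting it changes nothing and the search goes left. The path
    -- therefore ends with the edge to the old root, as `splayUp_final` requires.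
    rw [descend]
    split
    · rename_i h'; rw [hc.visit_eq] at h'; cases h'
    · rename_i h'; rw [hc.visit_eq] at h'; cases h'
      rw [if_neg (by omega), if_pos (by omega), val_step, e₁]
  obtain ⟨y, B', D, y₁, y₂, y₃, y₄, y₅⟩ := splayUp_final (b := b) hf q x.char r A B
  have hv : (find b f true (.node l x r) i).val =
      (mk b f (splayUp b f true (q ++ [Frame.left x.char r]) A B).val.1 c
        (splayUp b f true (q ++ [Frame.left x.char r]) A B).val.2).val := by
    simp [find, e]
  rw [hv, y₄] at h
  obtain ⟨z, -, -, -, hz⟩ := mk_val b f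
    (splayUp b f true (q ++ [Frame.left x.char r]) A B).val.1 (.node B' y D) c
  rw [hz] at h
  have hcl : (Tree.node B' y D).Clean := ⟨y₂, y₃⟩
  injection h with _ _ h
  rw [← h, hcl.visit_eq, hcl.visit_eq]
  exact ⟨B', y, D, rfl, y₁, y₅⟩

theorem substring_of_append {s P Y Q : List (Fin a)} {i j : ℕ} (hs : s = P ++ Y ++ Q)
    (hP : P.length + 1 = i) (hY : P.length + Y.length = j) :
    P = s.take (i - 1) ∧ Y = substring s i j ∧ Q = s.drop j := by
  subst hs hP hY
  refine ⟨by simp, ?_, by simp⟩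
  rw [substring, show P.length + Y.length + 1 - (P.length + 1) = Y.length by omega]
  simp

/-- The constants are those of two calls of `find` and one step. The ranks of the nodes on the
returned path are left out of `sidePot`, since `plug` rewrites these nodes and accounts for them. -/
theorem isolate_spec (hf : Function.Involutive f) {t : Tree a p} {i j : ℕ}
    (ht : t.WellFormed b f) (hij : IsRange (t.str f) i j) :
    ∃ y path, (isolate b f t i j).val = (y, path) ∧ y.WellFormed b f ∧ PathWellFormed b f path ∧
      path.length ≤ 2 ∧ pathPre f path = (t.str f).take (i - 1) ∧
      y.str f = substring (t.str f) i j ∧ pathPost f path = (t.str f).drop j ∧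
      y.count = j + 1 - i ∧ t.count = y.count + pathCount path ∧
      (isolate b f t i j).time + 2 * (y.pot + sidePot path) ≤
        2 * t.pot + 12 * rank t.count + 13 := by
  obtain ⟨hi, hj, hj'⟩ := hij
  have hs := ht.size_eq
  rw [Tree.length_str] at hj'
  have hrk := rank_nonneg t.count
  -- A factorization of the string with the right lengths determines all three parts, by
  -- `substring_of_append`.
  suffices H : ∃ y path, (isolate b f t i j).val = (y, path) ∧ y.WellFormed b f ∧
      PathWellFormed b f path ∧ path.length ≤ 2 ∧
      t.str f = pathPre f path ++ y.str f ++ pathPost f path ∧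
      (pathPre f path).length + 1 = i ∧ (pathPre f path).length + y.count = j ∧
      t.count = y.count + pathCount path ∧
      (isolate b f t i j).time + 2 * (y.pot + sidePot path) ≤
        2 * t.pot + 12 * rank t.count + 13 by
    obtain ⟨y, path, h₁, h₂, h₃, h₄, h₅, h₆, h₇, h₈, h₉⟩ := H
    obtain ⟨k₁, k₂, k₃⟩ := substring_of_append (j := j) h₅ h₆ (by rwa [Tree.length_str])
    exact ⟨y, path, h₁, h₂, h₃, h₄, k₁, k₂, k₃, by omega, h₈, h₉⟩
  unfold isolate
  rw [hs]
  by_cases h₁ : i = 1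
  · rw [if_pos h₁]
    by_cases h₂ : j = t.count
    · rw [if_pos h₂]
      refine ⟨t, [], rfl, ht, pathWellFormed_nil, by simp, by simp [pathPre, pathPost], ?_, ?_, ?_, ?_⟩
      · simp [pathPre, h₁]
      · simp [pathPre, h₂]
      · simp [pathCount]
      · simp [sidePot]; linarith
    · rw [if_neg h₂]
      obtain ⟨l, x, r, e₁, e₂, e₃, e₄, e₅, e₆, e₇⟩ :=
        find_spec hf false ht (show 1 ≤ j + 1 by omega) (by omega)
      refine ⟨l, [.left x.char r], by simp [e₁], e₃.1, pathWellFormed_cons.2 ⟨e₃.2.1,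
        pathWellFormed_nil⟩, by simp, ?_, ?_, ?_, ?_, ?_⟩
      · simp [pathPre, pathPost, e₄]
      · simp [pathPre, h₁]
      · simp [pathPre]; omega
      · simp [pathCount, Frame.side]; omega
      · simp [sidePot, Frame.side, e₁]; linarith
  · rw [if_neg h₁]
    by_cases h₂ : j = t.count
    · rw [if_pos h₂]
      obtain ⟨l, x, r, e₁, e₂, e₃, e₄, e₅, e₆, e₇⟩ :=
        find_spec hf false ht (show 1 ≤ i - 1 by omega) (by omega)
      refine ⟨r, [.right l x.char], by simp [e₁], e₃.2.1, pathWellFormed_cons.2 ⟨e₃.1,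
        pathWellFormed_nil⟩, by simp, ?_, ?_, ?_, ?_, ?_⟩
      · simp [pathPre, pathPost, e₄]
      · simp [pathPre, Tree.length_str]; omega
      · simp [pathPre, Tree.length_str]; omega
      · simp [pathCount, Frame.side]; omega
      · simp [sidePot, Frame.side, e₁]; linarith
    · rw [if_neg h₂]
      obtain ⟨l₁, x₁, r₁, e₁, e₂, e₃, e₄, e₅, e₆, e₇⟩ :=
        find_spec hf false ht (show 1 ≤ j + 1 by omega) (by omega)
      have hcn : (Tree.node l₁ x₁ r₁).count = t.count := by rw [e₆]; rfl
      obtain ⟨l, x, r, g₁, g₂, g₃, g₄, g₅, g₆, g₇⟩ :=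
        find_spec hf true e₃ (show 1 ≤ i - 1 by omega) (by omega)
      -- The node of in-order `j + 1`, the root after the first splay, is now the right child of the
      -- node of in-order `i - 1`; hence its left subtree represents exactly positions `i` to `j`.
      obtain ⟨B, y, D, k₁, k₂, k₃⟩ :=
        find_final hf e₂ e₃ (show 1 ≤ i - 1 by omega) (by omega) g₁
      obtain ⟨m₁, m₂, m₃, m₄, m₅⟩ := Tree.visit_eq_node hf k₁ g₃.2.1
      -- `D` is known only through its string, which already determines its size.
      have hD : D.count = r₁.count := by
        rw [← Tree.length_str (f := f), k₃, Tree.length_str]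
      have hpot : (Tree.node l₁ x₁ r₁).pot = l₁.pot + r₁.pot + rank t.count := by rw [e₆]; rfl
      have hrk' := rank_nonneg (B.count + 1 + D.count)
      refine ⟨B, [.left y.char D, .right l x.char], by simp [e₁, g₁, k₁], m₂.1,
        pathWellFormed_cons.2 ⟨m₂.2.1, pathWellFormed_cons.2 ⟨g₃.1, pathWellFormed_nil⟩⟩,
        by simp, ?_, ?_, ?_, ?_, ?_⟩
      · rw [e₂.str_node, ← e₄] at g₄
        simp [pathPre, pathPost, g₄, m₃]
      · simp [pathPre, Tree.length_str]; omega
      · simp [pathPre, Tree.length_str]; omega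
      · simp [pathCount, Frame.side]; omega
      · simp [sidePot, Frame.side, e₁, g₁, k₁]
        rw [hcn] at g₇
        linarith

/-- Each rewritten node lies in the final tree, so its rank is at most that of the root. -/
theorem plug_spec (hf : Function.Involutive f) (path : List (Frame a p)) {t : Tree a p}
    (ht : t.WellFormed b f) (hp : PathWellFormed b f path) :
    (plug b f t path).val.WellFormed b f ∧
      (plug b f t path).val.str f = pathPre f path ++ t.str f ++ pathPost f path ∧
      (plug b f t path).val.count = t.count + pathCount path ∧
      (plug b f t path).time = path.length ∧
      (plug b f t path).val.pot ≤
        t.pot + sidePot path + path.length * rank (t.count + pathCount path) := by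
  induction path generalizing t with
  | nil => simp [plug, ht, pathPre, pathPost, pathCount, sidePot]
  | cons e path ih =>
    rw [pathWellFormed_cons] at hp
    cases e with
    | left c r =>
      obtain ⟨h₁, h₂, h₃, h₄, h₅⟩ := ih (wellFormed_mk c hf ht hp.1) hp.2
      have hr := rank_mono (show t.count + 1 + r.count ≤ t.count + (r.count + 1 + pathCount path)
        by omega)
      simp only [count_mk, pot_mk, Frame.side] at h₁ h₂ h₃ h₄ h₅
      rw [show t.count + 1 + r.count + pathCount path = t.count + (r.count + 1 + pathCount path)
        by omega] at h₃ h₅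
      refine ⟨h₁, ?_, h₃, ?_, ?_⟩
      · simp [plug, h₂, str_mk c hf, pathPre, pathPost]
      · simp [plug, h₄]; omega
      · simp only [plug, Timed.val_bind, pathCount, sidePot, Frame.side, List.length_cons]
        push_cast
        linarith
    | right l c =>
      obtain ⟨h₁, h₂, h₃, h₄, h₅⟩ := ih (wellFormed_mk c hf hp.1 ht) hp.2
      have hr := rank_mono (show l.count + 1 + t.count ≤ t.count + (l.count + 1 + pathCount path)
        by omega)
      simp only [count_mk, pot_mk, Frame.side] at h₁ h₂ h₃ h₄ h₅
      rw [show l.count + 1 + t.count + pathCount path = t.count + (l.count + 1 + pathCount path)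
        by omega] at h₃ h₅
      refine ⟨h₁, ?_, h₃, ?_, ?_⟩
      · simp [plug, h₂, str_mk c hf, pathPre, pathPost]
      · simp [plug, h₄]; omega
      · simp only [plug, Timed.val_bind, pathCount, sidePot, Frame.side, List.length_cons]
        push_cast
        linarith

end Isolate
theorem Tree.pot_nonneg {a p : ℕ} (t : Tree a p) : 0 ≤ t.pot := by
  induction t with
  | null => exact le_rfl
  | node l x r hl hr =>
    have := rank_nonneg (l.count + 1 + r.count)
    simp only [Tree.pot]
    linarith

/-! ### The operations on trees -/

section Operations

variable {a p : ℕ} {b : ZMod p} {f : Fin a → Fin a}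

theorem take_append_substring_append_drop {s : List (Fin a)} {i j : ℕ} (h : IsRange s i j) :
    s.take (i - 1) ++ substring s i j ++ s.drop j = s := by
  obtain ⟨hi, hj, -⟩ := h
  have e : s.drop j = (s.drop (i - 1)).drop (j + 1 - i) := by
    rw [List.drop_drop]; congr 1; omega
  rw [substring, e, List.append_assoc, List.take_append_drop, List.take_append_drop]

/-- Isolating a substring and plugging in another tree. -/
theorem isolate_plug_spec (hf : Function.Involutive f) {t : Tree a p} {i j : ℕ}
    (ht : t.WellFormed b f) (hij : IsRange (t.str f) i j) :
    ∃ y path, (isolate b f t i j).val = (y, path) ∧ y.WellFormed b f ∧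
      y.str f = substring (t.str f) i j ∧ y.count = j + 1 - i ∧
      ∀ (u : Tree a p) (n : ℕ), u.WellFormed b f → t.count ≤ n → u.count + t.count ≤ n + y.count →
        (plug b f u path).val.WellFormed b f ∧
        (plug b f u path).val.str f = (t.str f).take (i - 1) ++ u.str f ++ (t.str f).drop j ∧
        (plug b f u path).time ≤ 2 ∧
        (isolate b f t i j).time + (plug b f u path).time +
            2 * ((plug b f u path).val.pot + y.pot) ≤
          2 * t.pot + 2 * u.pot + 31 * Op.lg n := by
  obtain ⟨y, path, h₁, h₂, h₃, h₄, h₅, h₆, h₇, h₈, h₉, h⟩ := isolate_spec hf ht hij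
  refine ⟨y, path, h₁, h₂, h₆, h₈, fun u n hu hn hun => ?_⟩
  obtain ⟨k₁, k₂, k₃, k₄, k₅⟩ := plug_spec hf path hu h₃
  rw [h₅, h₇] at k₂
  refine ⟨k₁, k₂, k₄ ▸ h₄, ?_⟩
  have r₁ := (rank_mono hn).trans (rank_le_lg n)
  have r₂ := (rank_mono (show u.count + pathCount path ≤ n by omega)).trans (rank_le_lg n)
  have r₃ := rank_nonneg (u.count + pathCount path)
  have r₄ := one_le_lg n
  have hl : (path.length : ℝ) ≤ 2 := by exact_mod_cast h₄
  have := mul_le_mul_of_nonneg_right hl r₃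
  rw [k₄]
  -- The total is `12 + 4` ranks, each at most `lg n`, and `13 + 2` steps, each at most `lg n`
  -- because `lg n ≥ 1`; this gives 31.
  linarith

/-- One step is charged for each of the `n` nodes and `n + 1` null pointers. The tree keeps its
shape up to mirroring, hence its potential. -/
theorem traverse_spec (hf : Function.Involutive f) (t : Tree a p) (acc : List (Fin a))
    (ht : t.WellFormed b f) :
    (traverse f t acc).val.1.WellFormed b f ∧ (traverse f t acc).val.1.str f = t.str f ∧
      (traverse f t acc).val.2 = t.str f ++ acc ∧ (traverse f t acc).val.1.count = t.count ∧
      (traverse f t acc).val.1.pot = t.pot ∧ (traverse f t acc).time = 2 * t.count + 1 := by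
  induction hn : t.count using Nat.strong_induction_on generalizing t acc with
  | _ n ih =>
  subst hn
  rw [traverse]
  split
  · rename_i h
    rw [Tree.visit_eq_null h]
    exact ⟨trivial, rfl, rfl, rfl, rfl, rfl⟩
  · rename_i l x r h
    obtain ⟨hc, hw, hs, hcn, hp⟩ := Tree.visit_eq_node hf h ht
    obtain ⟨hl, hr, hx⟩ := hw
    obtain ⟨r₁, r₂, r₃, r₄, r₅, r₆⟩ := ih r.count (by omega) r acc hr rfl
    obtain ⟨l₁, l₂, l₃, l₄, l₅, l₆⟩ :=
      ih l.count (by omega) l (x.char :: (traverse f r acc).val.2) hl rfl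
    refine ⟨⟨l₁, r₁, ?_⟩, ?_, ?_, ?_, ?_, ?_⟩
    · rw [l₂, r₂]; exact hx
    · rw [hs, ← hc.str_node]
      simp only [val_step, Timed.val_bind, Timed.val_pure, Tree.str, l₂, r₂]
    · simp only [val_step, Timed.val_bind, Timed.val_pure]
      rw [l₃, r₃, hs]
      simp
    · simp [Tree.count, l₄, r₄, hcn]
    · simp [Tree.pot, l₄, r₄, l₅, r₅, hp]
    · simp [l₆, r₆, hcn]; omega

/-- The summand `- rank n` strengthens the linear bound enough for induction: the halves contribute
two negative ranks, which absorb the rank of the new root. -/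
theorem build_spec (hf : Function.Involutive f) (n : ℕ) (w : List (Fin a)) (hn : n ≤ w.length) :
    (build b f n w).val.1.WellFormed b f ∧ (build b f n w).val.1.str f = w.take n ∧
      (build b f n w).val.2 = w.drop n ∧ (build b f n w).val.1.count = n ∧
      (build b f n w).time = 2 * n + 1 ∧ (build b f n w).val.1.pot ≤ 4 * n - rank n := by
  induction n using Nat.strong_induction_on generalizing w with
  | _ n ih =>
  cases n with
  | zero =>
    rw [build]
    exact ⟨trivial, rfl, rfl, rfl, rfl, by simp [Tree.pot, rank]⟩
  | succ n =>
    obtain ⟨l₁, l₂, l₃, l₄, l₅, l₆⟩ := ih (n / 2) (by omega) w (by omega)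
    have hd : w.drop (n / 2) = w[n / 2]'(by omega) :: w.drop (n / 2 + 1) :=
      List.drop_eq_getElem_cons _
    obtain ⟨r₁, r₂, r₃, r₄, r₅, r₆⟩ :=
      ih (n - n / 2) (by omega) (w.drop (n / 2 + 1)) (by simp; omega)
    rw [build]
    simp only [Timed.val_bind, Timed.time_bind, l₃, hd, Timed.val_pure, Timed.time_pure, time_mk,
      count_mk, pot_mk, str_mk _ hf]
    refine ⟨wellFormed_mk _ hf l₁ r₁, ?_, ?_, ?_, ?_, ?_⟩
    · rw [l₂, r₂]
      conv_rhs => rw [show n + 1 = n / 2 + (n - n / 2 + 1) by omega, List.take_add, hd]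
      rfl
    · rw [r₃, List.drop_drop]; congr 1; omega
    · omega
    · omega
    · rw [l₄, r₄, show n / 2 + 1 + (n - n / 2) = n + 1 by omega]
      have hsum : ((n / 2 : ℕ) : ℝ) + ((n - n / 2 : ℕ) : ℝ) = n := by
        exact_mod_cast (by omega : n / 2 + (n - n / 2) = n)
      -- Both halves have about half the size, so each loses little more than one unit of rank.
      -- After exponentiation the claim is `(n + 2) ^ 2 ≤ 16 (⌊n/2⌋ + 1) (⌈n/2⌉ + 1)`, and the right
      -- side is at least `4 (n + 1) (n + 2)`.
      have hmin : 2 * rank (n + 1) ≤ rank (n / 2) + rank (n - n / 2) + 4 := by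
        have h4 : (4 : ℝ) = Real.logb 2 16 := by
          rw [show (16 : ℝ) = 2 ^ (4 : ℝ) by norm_num, Real.logb_rpow] <;> norm_num
        have e : 2 * rank (n + 1) = Real.logb 2 ((((n + 1 : ℕ) : ℝ) + 1) ^ 2) := by
          rw [Real.logb_pow]; rfl
        rw [e, h4]
        unfold rank
        rw [← Real.logb_mul (by positivity) (by positivity),
          ← Real.logb_mul (by positivity) (by norm_num)]
        refine Real.logb_le_logb_of_le one_lt_two (by positivity) ?_
        have h₁ : (n : ℝ) + 1 ≤ 2 * ((n / 2 : ℕ) + 1) := by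
          exact_mod_cast (by omega : n + 1 ≤ 2 * (n / 2 + 1))
        have h₂ : (n : ℝ) + 2 ≤ 2 * ((n - n / 2 : ℕ) + 1) := by
          exact_mod_cast (by omega : n + 2 ≤ 2 * (n - n / 2 + 1))
        have h₃ := mul_le_mul h₁ h₂ (by positivity) (by positivity)
        push_cast
        have : (0 : ℝ) ≤ n := by positivity
        nlinarith
      push_cast
      linarith

theorem makeString_spec (hf : Function.Involutive f) (w : List (Fin a)) :
    (makeString b f w).val.WellFormed b f ∧ (makeString b f w).val.str f = w ∧
      (makeString b f w).time = 2 * w.length + 1 ∧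
      (makeString b f w).val.pot ≤ 4 * w.length := by
  obtain ⟨h₁, h₂, -, -, h₅, h₆⟩ := build_spec (b := b) hf w.length w le_rfl
  have := rank_nonneg w.length
  rw [List.take_length] at h₂
  refine ⟨h₁, h₂, h₅, ?_⟩
  change (build b f w.length w).val.1.pot ≤ _
  linarith

theorem access_spec (hf : Function.Involutive f) {t : Tree a p} {i : ℕ} (ht : t.WellFormed b f)
    (hi : 1 ≤ i) (hi' : i ≤ (t.str f).length) :
    (access b f t i).val.1.WellFormed b f ∧ (access b f t i).val.1.str f = t.str f ∧
      (access b f t i).val.2 = (t.str f)[i - 1]? ∧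
      (access b f t i).time + 2 * (access b f t i).val.1.pot ≤
        2 * t.pot + 40 * Op.lg (t.str f).length := by
  rw [Tree.length_str] at *
  obtain ⟨l, x, r, e₁, e₂, e₃, e₄, e₅, e₆, e₇⟩ := find_spec hf false ht hi hi'
  have := rank_le_lg t.count
  have := one_le_lg t.count
  simp only [access, Timed.val_bind, Timed.time_bind, e₁, Timed.val_pure, Timed.time_pure]
  refine ⟨e₃, by rw [e₂.str_node, e₄], ?_, ?_⟩
  · rw [e₄, ← e₅, List.getElem?_append_right (by simp [Tree.length_str])]
    simp [Tree.length_str]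
  · rw [Tree.pot, ← e₆]
    push_cast
    linarith

theorem substitute_spec (hf : Function.Involutive f) {t : Tree a p} {i : ℕ} (c : Fin a)
    (ht : t.WellFormed b f) (hi : 1 ≤ i) (hi' : i ≤ (t.str f).length) :
    (substitute b f t i c).val.WellFormed b f ∧
      (substitute b f t i c).val.str f = (t.str f).take (i - 1) ++ c :: (t.str f).drop i ∧
      (substitute b f t i c).time + 2 * (substitute b f t i c).val.pot ≤
        2 * t.pot + 40 * Op.lg (t.str f).length := by
  rw [Tree.length_str] at *
  obtain ⟨l, x, r, e₁, e₂, e₃, e₄, e₅, e₆, e₇⟩ := find_spec hf false ht hi hi'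
  have := rank_le_lg t.count
  have := one_le_lg t.count
  simp only [substitute, Timed.val_bind, Timed.time_bind, e₁]
  refine ⟨wellFormed_mk _ hf e₃.1 e₃.2.1, ?_, ?_⟩
  · rw [str_mk _ hf, e₄, ← e₅, ← Tree.length_str (f := f)]; simp
  · rw [pot_mk, time_mk, ← e₆]
    push_cast
    linarith

theorem insert_spec (hf : Function.Involutive f) {t : Tree a p} {i : ℕ} (c : Fin a)
    (ht : t.WellFormed b f) (hi : 1 ≤ i) (hi' : i ≤ (t.str f).length + 1) :
    (insert b f t i c).val.WellFormed b f ∧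
      (insert b f t i c).val.str f = (t.str f).take (i - 1) ++ c :: (t.str f).drop (i - 1) ∧
      (insert b f t i c).time + 2 * (insert b f t i c).val.pot ≤
        2 * t.pot + 40 * Op.lg (t.str f).length := by
  have r₁ := rank_le_lg t.count
  have r₂ := one_le_lg t.count
  have r₃ := rank_succ t.count
  have r₄ := rank_nonneg t.count
  rw [Tree.length_str] at *
  unfold insert
  rw [ht.size_eq]
  split_ifs with h
  · obtain ⟨l, x, r, e₁, e₂, e₃, e₄, e₅, e₆, e₇⟩ := find_spec hf false ht hi h
    simp only [Timed.val_bind, Timed.time_bind, e₁]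
    refine ⟨wellFormed_mk _ hf e₃.1 (wellFormed_mk _ hf trivial e₃.2.1), ?_, ?_⟩
    · rw [str_mk _ hf, str_mk _ hf, e₄, ← e₅, ← Tree.length_str (f := f)]; simp [Tree.str]
    · have r₅ := rank_mono (show 0 + 1 + r.count ≤ t.count by omega)
      simp only [pot_mk, time_mk, count_mk, Tree.pot, Tree.count]
      rw [show l.count + 1 + (0 + 1 + r.count) = t.count + 1 by omega]
      push_cast
      linarith
  -- Here `i` is one past the end, and the new node is placed above the whole tree.
  · refine ⟨wellFormed_mk _ hf ht trivial, ?_, ?_⟩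
    · have e : i - 1 = (t.str f).length := by rw [Tree.length_str]; omega
      rw [str_mk _ hf, e]; simp [Tree.str]
    · simp only [pot_mk, time_mk, Tree.pot, Tree.count, add_zero]
      push_cast
      linarith

theorem join_spec (hf : Function.Involutive f) {l r : Tree a p} {n : ℕ} (hl : l.WellFormed b f)
    (hr : r.WellFormed b f) (hn : l.count + r.count ≤ n) :
    (join b f l r).val.WellFormed b f ∧ (join b f l r).val.str f = l.str f ++ r.str f ∧
      (join b f l r).time + 2 * (join b f l r).val.pot ≤
        2 * l.pot + 2 * r.pot + 15 * Op.lg n := by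
  have r₁ := one_le_lg n
  cases l with
  | null =>
    refine ⟨hr, rfl, ?_⟩
    simp [join, Tree.pot]
    linarith
  | node l₀ x₀ r₀ =>
    unfold join
    dsimp only
    have h₀ : 1 ≤ (Tree.node l₀ x₀ r₀).count := by simp only [Tree.count]; omega
    generalize Tree.node l₀ x₀ r₀ = l at *
    obtain ⟨l', x, r', e₁, e₂, e₃, e₄, e₅, e₆, e₇⟩ :=
      find_spec hf false hl h₀ le_rfl
    -- The last node of `l` was splayed, so nothing is to its right and `r` can take that place.
    have e : r'.str f = [] := by
      rw [← List.length_eq_zero_iff, Tree.length_str]; omega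
    have r₂ := (rank_mono (show l.count ≤ n by omega)).trans (rank_le_lg n)
    have r₃ := (rank_mono (show l'.count + 1 + r.count ≤ n by omega)).trans (rank_le_lg n)
    have r₄ := rank_nonneg l.count
    have r₅ := r'.pot_nonneg
    simp only [Timed.val_bind, Timed.time_bind, hl.size_eq, e₁]
    refine ⟨wellFormed_mk _ hf e₃.1 hr, ?_, ?_⟩
    · rw [str_mk _ hf, e₄, e]; simp
    · simp only [pot_mk, time_mk]
      push_cast
      linarith

theorem delete_spec (hf : Function.Involutive f) {t : Tree a p} {i : ℕ}
    (ht : t.WellFormed b f) (hi : 1 ≤ i) (hi' : i ≤ (t.str f).length) :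
    (delete b f t i).val.WellFormed b f ∧
      (delete b f t i).val.str f = (t.str f).take (i - 1) ++ (t.str f).drop i ∧
      (delete b f t i).time + 2 * (delete b f t i).val.pot ≤
        2 * t.pot + 40 * Op.lg (t.str f).length := by
  rw [Tree.length_str] at *
  obtain ⟨l, x, r, e₁, e₂, e₃, e₄, e₅, e₆, e₇⟩ := find_spec hf false ht hi hi'
  have r₁ := rank_le_lg t.count
  have r₂ := one_le_lg t.count
  have r₃ := rank_nonneg t.count
  obtain ⟨k₁, k₂, k₃⟩ := join_spec hf e₃.1 e₃.2.1 (show l.count + r.count ≤ t.count by omega)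
  simp only [delete, Timed.val_bind, Timed.time_bind, e₁]
  refine ⟨k₁, ?_, ?_⟩
  · rw [k₂, e₄, ← e₅, ← Tree.length_str (f := f)]; simp
  · push_cast
    linarith

theorem retrieve_spec (hf : Function.Involutive f) {t : Tree a p} {i j : ℕ}
    (ht : t.WellFormed b f) (hij : IsRange (t.str f) i j) :
    (retrieve b f t i j).val.1.WellFormed b f ∧ (retrieve b f t i j).val.1.str f = t.str f ∧
      (retrieve b f t i j).val.2 = substring (t.str f) i j ∧
      (retrieve b f t i j).time ≤ (isolate b f t i j).time + (2 * (j + 1 - i) + 3) ∧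
      (retrieve b f t i j).time + 2 * (retrieve b f t i j).val.1.pot ≤
        2 * t.pot + 2 * (j + 1 - i : ℕ) + 40 * Op.lg (t.str f).length := by
  obtain ⟨y, path, e, h₁, h₂, h₃, h⟩ := isolate_plug_spec hf ht hij
  obtain ⟨t₁, t₂, t₃, t₄, t₅, t₆⟩ := traverse_spec hf y [] h₁
  obtain ⟨k₁, k₂, k₃, k₄⟩ := h (traverse f y []).val.1 t.count t₁ le_rfl (by omega)
  have r₁ := one_le_lg t.count
  rw [Tree.length_str]
  rw [t₂, h₂, take_append_substring_append_drop hij] at k₂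
  simp only [retrieve, Timed.val_bind, Timed.time_bind, e, Timed.val_pure, Timed.time_pure]
  refine ⟨k₁, k₂, by rw [t₃, h₂, List.append_nil], by omega, ?_⟩
  rw [t₆, h₃]
  push_cast
  linarith

theorem introduce_spec (hf : Function.Involutive f) {t₁ t₂ : Tree a p} {i : ℕ}
    (h₁ : t₁.WellFormed b f) (h₂ : t₂.WellFormed b f) (hi : 1 ≤ i)
    (hi' : i ≤ (t₁.str f).length + 1) :
    (introduce b f t₁ i t₂).val.WellFormed b f ∧
      (introduce b f t₁ i t₂).val.str f =
        (t₁.str f).take (i - 1) ++ t₂.str f ++ (t₁.str f).drop (i - 1) ∧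
      (introduce b f t₁ i t₂).time + 2 * (introduce b f t₁ i t₂).val.pot ≤
        2 * t₁.pot + 2 * t₂.pot + 40 * Op.lg ((t₁.str f).length + (t₂.str f).length) := by
  -- The range from `i` to `i - 1` is empty: isolating it opens the gap into which the second tree
  -- is put.
  obtain ⟨y, path, e, -, -, -, h⟩ :=
    isolate_plug_spec hf h₁ (show IsRange (t₁.str f) i (i - 1) from ⟨hi, by omega, by omega⟩)
  obtain ⟨k₁, k₂, -, k₄⟩ := h t₂ (t₁.count + t₂.count) h₂ (by omega) (by omega)
  have r₁ := one_le_lg (t₁.count + t₂.count)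
  have r₂ := y.pot_nonneg
  rw [Tree.length_str, Tree.length_str]
  simp only [introduce, Timed.val_bind, Timed.time_bind, e]
  refine ⟨k₁, k₂, ?_⟩
  push_cast
  linarith

theorem extract_spec (hf : Function.Involutive f) {t : Tree a p} {i j : ℕ}
    (ht : t.WellFormed b f) (hij : IsRange (t.str f) i j) :
    (extract b f t i j).val.1.WellFormed b f ∧ (extract b f t i j).val.2.WellFormed b f ∧
      (extract b f t i j).val.1.str f = (t.str f).take (i - 1) ++ (t.str f).drop j ∧
      (extract b f t i j).val.2.str f = substring (t.str f) i j ∧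
      (extract b f t i j).time +
          2 * ((extract b f t i j).val.1.pot + (extract b f t i j).val.2.pot) ≤
        2 * t.pot + 40 * Op.lg (t.str f).length := by
  obtain ⟨y, path, e, h₁, h₂, -, h⟩ := isolate_plug_spec hf ht hij
  obtain ⟨k₁, k₂, -, k₄⟩ := h .null t.count trivial le_rfl (by simp [Tree.count])
  have r₁ := one_le_lg t.count
  rw [Tree.length_str]
  simp only [extract, Timed.val_bind, Timed.time_bind, e, Timed.val_pure, Timed.time_pure]
  refine ⟨k₁, h₁, by simpa [Tree.str] using k₂, h₂, ?_⟩
  simp only [Tree.pot] at k₄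
  push_cast
  linarith

theorem reverse_spec (hf : Function.Involutive f) {t : Tree a p} {i j : ℕ}
    (ht : t.WellFormed b f) (hij : IsRange (t.str f) i j) :
    (reverse b f t i j).val.WellFormed b f ∧
      (reverse b f t i j).val.str f = (t.str f).take (i - 1) ++
        (substring (t.str f) i j).reverse ++ (t.str f).drop j ∧
      (reverse b f t i j).time + 2 * (reverse b f t i j).val.pot ≤
        2 * t.pot + 40 * Op.lg (t.str f).length := by
  obtain ⟨y, path, e, h₁, h₂, -, h⟩ := isolate_plug_spec hf ht hij
  obtain ⟨k₁, k₂, -, k₄⟩ := h y.toggleRev t.count h₁.toggleRev le_rfl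
    (by rw [Tree.count_toggleRev, add_comm])
  have r₁ := one_le_lg t.count
  rw [Tree.length_str]
  rw [Tree.str_toggleRev, h₂] at k₂
  rw [Tree.pot_toggleRev] at k₄
  simp only [reverse, Timed.val_bind, Timed.time_bind, e]
  refine ⟨k₁, k₂, ?_⟩
  push_cast
  linarith

theorem map_spec (hf : Function.Involutive f) {t : Tree a p} {i j : ℕ}
    (ht : t.WellFormed b f) (hij : IsRange (t.str f) i j) :
    (map b f t i j).val.WellFormed b f ∧
      (map b f t i j).val.str f = (t.str f).take (i - 1) ++
        (substring (t.str f) i j).map f ++ (t.str f).drop j ∧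
      (map b f t i j).time + 2 * (map b f t i j).val.pot ≤
        2 * t.pot + 40 * Op.lg (t.str f).length := by
  obtain ⟨y, path, e, h₁, h₂, -, h⟩ := isolate_plug_spec hf ht hij
  obtain ⟨k₁, k₂, -, k₄⟩ := h y.toggleMap t.count h₁.toggleMap le_rfl
    (by rw [Tree.count_toggleMap, add_comm])
  have r₁ := one_le_lg t.count
  rw [Tree.length_str]
  rw [Tree.str_toggleMap hf, h₂] at k₂
  rw [Tree.pot_toggleMap] at k₄
  simp only [map, Timed.val_bind, Timed.time_bind, e]
  refine ⟨k₁, k₂, ?_⟩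
  push_cast
  linarith

theorem substringFp_spec (hf : Function.Involutive f) {t : Tree a p} {i j : ℕ}
    (ht : t.WellFormed b f) (hij : IsRange (t.str f) i j) :
    (substringFp b f t i j).val.1.WellFormed b f ∧
      (substringFp b f t i j).val.1.str f = t.str f ∧
      (substringFp b f t i j).val.2 = fingerprint b (substring (t.str f) i j) ∧
      (substringFp b f t i j).time + 2 * (substringFp b f t i j).val.1.pot ≤
        2 * t.pot + 40 * Op.lg (t.str f).length := by
  obtain ⟨y, path, e, h₁, h₂, -, h⟩ := isolate_plug_spec hf ht hij
  obtain ⟨k₁, k₂, -, k₄⟩ := h y t.count h₁ le_rfl (by rw [add_comm])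
  have r₁ := one_le_lg t.count
  rw [Tree.length_str]
  rw [h₂, take_append_substring_append_drop hij] at k₂
  simp only [substringFp, Timed.val_bind, Timed.time_bind, e, Timed.val_pure, Timed.time_pure]
  refine ⟨k₁, k₂, ?_, ?_⟩
  · rw [(h₁.visit hf).fp_eq (Tree.clean_visit y), Tree.str_visit hf, h₂]
  · push_cast
    linarith

end Operations
/-! ### Lists of optional entries -/

section Lookup

variable {α β : Type}

theorem lookup_lt {L : List (Option α)} {h : ℕ} {x : α} (hx : lookup L h = some x) :
    h < L.length := by
  by_contra hlt
  rw [lookup, List.getElem?_eq_none (by omega)] at hx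
  cases hx

theorem getElem?_of_lookup {L : List (Option α)} {h : ℕ} {x : α} (hx : lookup L h = some x) :
    L[h]? = some (some x) := by
  have := lookup_lt hx
  rw [lookup, List.getElem?_eq_getElem this] at hx
  rw [List.getElem?_eq_getElem this]
  exact congrArg some hx

theorem lookup_set_self {L : List (Option α)} {h : ℕ} (o : Option α) (hh : h < L.length) :
    lookup (L.set h o) h = o := by
  simp [lookup, hh]

theorem lookup_set_ne {L : List (Option α)} {h k : ℕ} (o : Option α) (hk : h ≠ k) :
    lookup (L.set h o) k = lookup L k := by
  simp [lookup, List.getElem?_set_ne hk]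

theorem lookup_append_singleton {L : List (Option α)} {o : Option α} {h : ℕ} {x : α}
    (hx : lookup (L ++ [o]) h = some x) : lookup L h = some x ∨ o = some x := by
  unfold lookup at *
  rcases lt_trichotomy h L.length with hl | hl | hl
  · rw [List.getElem?_append_left hl] at hx; exact .inl hx
  · subst hl; right; simpa using hx
  · rw [List.getElem?_eq_none (by simp; omega)] at hx; cases hx

theorem set_of_lookup {L : List (Option α)} {h : ℕ} {x : α} (hx : lookup L h = some x) :
    L.set h (some x) = L := by
  have hl := lookup_lt hx
  have := getElem?_of_lookup hx
  rw [List.getElem?_eq_getElem hl] at this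
  rw [← Option.some.inj this, List.set_getElem_self]

theorem lookup_map (L : List (Option α)) (g : α → β) (h : ℕ) :
    lookup (L.map fun o => o.map g) h = (lookup L h).map g := by
  unfold lookup
  rw [List.getElem?_map]
  cases L[h]? <;> rfl

end Lookup

/-! ### From single trees to the forest: space, amortized time, sequences of operations -/

namespace Forest

variable {a p : ℕ} {b : ZMod p} {f : Fin a → Fin a}

/-- The potential of a possibly destroyed tree. -/
noncomputable def optionPot : Option (Tree a p) → ℝ
  | none => 0
  | some t => t.pot

/-- The sum of the potentials of the trees. -/
noncomputable def pot (F : Forest a p) : ℝ := (F.map optionPot).sum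

theorem pot_nonneg (F : Forest a p) : 0 ≤ F.pot := by
  refine List.sum_nonneg fun x hx => ?_
  obtain ⟨o, -, rfl⟩ := List.mem_map.1 hx
  cases o with
  | none => exact le_rfl
  | some t => exact t.pot_nonneg

theorem pot_append_singleton (F : Forest a p) (t : Tree a p) :
    pot (F ++ [some t]) = pot F + t.pot := by
  simp [pot, optionPot]

theorem pot_set {F : Forest a p} {h : ℕ} {t : Tree a p} (ht : lookup F h = some t)
    (o : Option (Tree a p)) : pot (F.set h o) = pot F - t.pot + optionPot o := by
  replace ht := getElem?_of_lookup ht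
  induction F generalizing h with
  | nil => simp at ht
  | cons o' F ih =>
    cases h with
    | zero =>
      simp only [List.getElem?_cons_zero, Option.some.injEq] at ht
      simp [pot, ht, optionPot]; ring
    | succ h =>
      have := ih (h := h) (by simpa using ht)
      simp only [pot, List.set_cons_succ, List.map_cons, List.sum_cons] at this ⊢
      rw [this]; ring

theorem strings_set (F : Forest a p) (h : ℕ) (t : Tree a p) :
    strings f (F.set h (some t)) = (F.strings f).set h (some (t.str f)) := by
  simp [strings, List.map_set]

theorem WellFormed.set {F : Forest a p} (hF : F.WellFormed b f) (h : ℕ) {o : Option (Tree a p)}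
    (ho : ∀ t, o = some t → t.WellFormed b f) : WellFormed b f (F.set h o) := by
  intro k u hk
  by_cases e : h = k
  · subst e
    have hl := lookup_lt hk
    rw [List.length_set] at hl
    rw [lookup_set_self _ hl] at hk
    exact ho u hk
  · rw [lookup_set_ne _ e] at hk
    exact hF k u hk

theorem WellFormed.append_singleton {F : Forest a p} (hF : F.WellFormed b f) {t : Tree a p}
    (ht : t.WellFormed b f) : WellFormed b f (F ++ [some t]) := by
  intro k u hk
  rcases lookup_append_singleton hk with hk | hk
  · exact hF k u hk
  · cases hk; exact ht

theorem exists_of_live {F : Forest a p} {h : ℕ} (hF : F.WellFormed b f)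
    (hh : (F.strings f).Live h) :
    lookup F h = some (F.tree h) ∧ (F.tree h).WellFormed b f ∧
      (F.strings f).str h = (F.tree h).str f ∧
      (F.strings f).set h (some ((F.strings f).str h)) = F.strings f := by
  unfold Collection.Live strings at hh
  rw [lookup_map, Option.isSome_map, Option.isSome_iff_exists] at hh
  obtain ⟨t, ht⟩ := hh
  have h₁ : F.tree h = t := by rw [tree, ht]; rfl
  have h₂ : lookup (F.strings f) h = some (t.str f) := by
    rw [strings, lookup_map, ht]; rfl
  have h₃ : (F.strings f).str h = t.str f := by rw [Collection.str, h₂]; rfl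
  exact ⟨by rw [h₁, ht], h₁ ▸ hF h t ht, by rw [h₁, h₃], by rw [h₃, set_of_lookup h₂]⟩

/-- A tree with `n ≥ 1` nodes uses `1 + 11 n ≤ 12 n` words; the root pointer of an empty tree is
charged to `numEmpty`. -/
theorem space_le (F : Forest a p) :
    F.space ≤ 12 * ((F.strings f).total + (F.strings f).numEmpty) := by
  induction F with
  | nil => simp [space]
  | cons o F ih =>
    simp only [space, strings, Collection.total, Collection.numEmpty, List.map_cons, List.sum_cons,
      List.countP_cons] at ih ⊢
    cases o with
    | none => simp [-List.map_map, -List.countP_map]; omega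
    | some t =>
      have := Tree.length_str (f := f) t
      by_cases e : t.str f = []
      · simp [e, -List.map_map, -List.countP_map] at this ⊢; omega
      · have := List.length_pos_iff.2 e
        simp [e, -List.map_map, -List.countP_map]; omega

/-- An operation that only changes the tree of one string. -/
theorem set_spec {F : Forest a p} (hF : F.WellFormed b f) {h : ℕ} {t t' : Tree a p} {C : ℝ}
    {n : ℕ} (ht : lookup F h = some t) (ht' : t'.WellFormed b f)
    (hn : n + 2 * t'.pot ≤ 2 * t.pot + C) :
    WellFormed b f (F.set h (some t')) ∧ n + 2 * pot (F.set h (some t')) ≤ 2 * F.pot + C := by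
  refine ⟨hF.set h fun u hu => by cases hu; exact ht', ?_⟩
  rw [pot_set ht, optionPot]
  linarith

theorem exec_equal_spec (hf : Function.Involutive f) {F : Forest a p} (hF : F.WellFormed b f)
    {h₁ i₁ h₂ i₂ len : ℕ} (hv : (Op.equal h₁ i₁ h₂ i₂ len : Op a).Valid (F.strings f)) :
    (exec b f F (.equal h₁ i₁ h₂ i₂ len)).val.1.strings f = F.strings f ∧
      (exec b f F (.equal h₁ i₁ h₂ i₂ len)).val.1.WellFormed b f ∧
      (exec b f F (.equal h₁ i₁ h₂ i₂ len)).time +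
          2 * (exec b f F (.equal h₁ i₁ h₂ i₂ len)).val.1.pot ≤
        2 * F.pot + 100 * (Op.equal h₁ i₁ h₂ i₂ len : Op a).bound (F.strings f) ∧
      (exec b f F (.equal h₁ i₁ h₂ i₂ len)).val.2 =
        .bool (decide (fingerprint b (substring ((F.strings f).str h₁) i₁ (i₁ + len - 1)) =
          fingerprint b (substring ((F.strings f).str h₂) i₂ (i₂ + len - 1)))) := by
  obtain ⟨l₁, l₂, i₁', i₁'', i₂', i₂''⟩ := hv
  obtain ⟨e₁, w₁, s₁, t₁⟩ := exists_of_live hF l₁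
  obtain ⟨k₁, k₂, k₃, k₄⟩ := substringFp_spec hf w₁
    (show IsRange _ i₁ (i₁ + len - 1) from ⟨i₁', by omega, by rw [← s₁]; omega⟩)
  obtain ⟨m₁, m₂⟩ := set_spec hF e₁ k₁ k₄
  -- The first isolation rearranges a tree but represents the same collection, so the second one may
  -- be analysed in the new forest, even when both handles coincide.
  have hs : strings f (F.set h₁ (some (substringFp b f (F.tree h₁) i₁ (i₁ + len - 1)).val.1)) =
      F.strings f := by
    rw [strings_set, k₂, ← s₁, t₁]
  generalize hF₁ : F.set h₁ (some (substringFp b f (F.tree h₁) i₁ (i₁ + len - 1)).val.1) = F₁ at *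
  rw [← hs] at l₂ i₂'' t₁
  obtain ⟨e₂, w₂, s₂, t₂⟩ := exists_of_live m₁ l₂
  obtain ⟨g₁, g₂, g₃, g₄⟩ := substringFp_spec hf w₂
    (show IsRange _ i₂ (i₂ + len - 1) from ⟨i₂', by omega, by rw [← s₂]; omega⟩)
  obtain ⟨n₁, n₂⟩ := set_spec m₁ e₂ g₁ g₄
  simp only [exec, val_step, time_step, Timed.val_bind, Timed.time_bind, Timed.val_pure,
    Timed.time_pure, hF₁]
  refine ⟨?_, n₁, ?_, ?_⟩
  · rw [strings_set, g₂, ← s₂, t₂, hs]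
  · rw [← s₁] at m₂
    rw [← s₂, hs] at n₂
    have q₁ := lg_mono (Nat.le_add_right ((F.strings f).str h₁).length
      ((F.strings f).str h₂).length)
    have q₂ := lg_mono (Nat.le_add_left ((F.strings f).str h₂).length
      ((F.strings f).str h₁).length)
    have q₃ := one_le_lg (((F.strings f).str h₁).length + ((F.strings f).str h₂).length)
    simp only [Op.bound]
    push_cast
    linarith
  · rw [k₃, g₃, ← s₁, ← s₂, hs]

theorem exec_spec (hf : Function.Involutive f) {F : Forest a p} (hF : F.WellFormed b f) (o : Op a)
    (ho : o.Valid (F.strings f)) :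
    (exec b f F o).val.1.strings f = (o.spec f (F.strings f)).1 ∧
      (exec b f F o).val.1.WellFormed b f ∧
      (exec b f F o).time + 2 * (exec b f F o).val.1.pot ≤
        2 * F.pot + 100 * o.bound (F.strings f) ∧
      (¬ o.IsEqual → (exec b f F o).val.2 = (o.spec f (F.strings f)).2) := by
  have hlen : (F.strings f).length = F.length := by simp [strings]
  cases o with
  | equal h₁ i₁ h₂ i₂ len =>
    obtain ⟨k₁, k₂, k₃, -⟩ := exec_equal_spec hf hF ho
    exact ⟨k₁, k₂, k₃, fun h => (h trivial).elim⟩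
  | makeString w =>
    obtain ⟨k₁, k₂, k₃, k₄⟩ := makeString_spec (b := b) hf w
    simp only [exec, val_step, time_step, Timed.val_bind, Timed.time_bind, Timed.val_pure,
      Timed.time_pure, Op.spec, Op.bound]
    refine ⟨?_, hF.append_singleton k₁, ?_, fun _ => by rw [hlen]⟩
    · simp [strings, k₂]
    · rw [pot_append_singleton, k₃]
      have : (0 : ℝ) ≤ w.length := by positivity
      push_cast
      linarith
  | introduce h₁ i h₂ =>
    obtain ⟨l₁, l₂, hne, hi, hi'⟩ := ho
    obtain ⟨e₁, w₁, s₁, -⟩ := exists_of_live hF l₁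
    obtain ⟨e₂, w₂, s₂, -⟩ := exists_of_live hF l₂
    obtain ⟨k₁, k₂, k₃⟩ := introduce_spec hf w₁ w₂ hi (s₁ ▸ hi')
    -- Distinctness of the handles matters here: the second tree is still in place after the first
    -- has been replaced, so its potential is released when its handle is cleared.
    have e₂' : lookup (F.set h₁ (some (introduce b f (F.tree h₁) i (F.tree h₂)).val)) h₂ =
        some (F.tree h₂) := by rw [lookup_set_ne _ hne, e₂]
    have q := one_le_lg (((F.strings f).str h₁).length + ((F.strings f).str h₂).length)
    simp only [exec, val_step, time_step, Timed.val_bind, Timed.time_bind, Timed.val_pure,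
      Timed.time_pure, Op.spec, Op.bound]
    refine ⟨?_, ?_, ?_, fun _ => trivial⟩
    · rw [s₁, s₂, ← k₂, ← strings_set]
      simp [strings, List.map_set]
    · exact (hF.set h₁ fun u hu => by cases hu; exact k₁).set h₂ (by simp)
    · rw [pot_set e₂', pot_set e₁, optionPot, optionPot]
      rw [← s₁, ← s₂] at k₃
      push_cast
      linarith
  | extract h i j =>
    obtain ⟨l, hr⟩ := ho
    obtain ⟨e, w, s, -⟩ := exists_of_live hF l
    obtain ⟨k₁, k₂, k₃, k₄, k₅⟩ := extract_spec hf w (s ▸ hr)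
    have q := one_le_lg ((F.strings f).str h).length
    simp only [exec, val_step, time_step, Timed.val_bind, Timed.time_bind, Timed.val_pure,
      Timed.time_pure, Op.spec, Op.bound]
    refine ⟨?_, ?_, ?_, fun _ => by rw [hlen]⟩
    · rw [s, ← k₃, ← k₄, ← strings_set]
      simp [strings]
    · exact (hF.set h fun u hu => by cases hu; exact k₁).append_singleton k₂
    · rw [pot_append_singleton, pot_set e, optionPot]
      rw [← s] at k₅
      push_cast
      linarith
  | access h i =>
    obtain ⟨l, hi, hi'⟩ := ho
    obtain ⟨e, w, s, d⟩ := exists_of_live hF l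
    obtain ⟨k₁, k₂, k₃, k₄⟩ := access_spec hf w hi (s ▸ hi')
    obtain ⟨m₁, m₂⟩ := set_spec hF e k₁ k₄
    have q := one_le_lg ((F.strings f).str h).length
    simp only [exec, val_step, time_step, Timed.val_bind, Timed.time_bind, Timed.val_pure,
      Timed.time_pure, Op.spec, Op.bound]
    refine ⟨by rw [strings_set, k₂, ← s, d], m₁, ?_, fun _ => by rw [k₃, s]⟩
    rw [← s] at m₂
    push_cast
    linarith
  | retrieve h i j =>
    obtain ⟨l, hr⟩ := ho
    obtain ⟨e, w, s, d⟩ := exists_of_live hF l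
    obtain ⟨k₁, k₂, k₃, -, k₄⟩ := retrieve_spec hf w (s ▸ hr)
    rw [add_assoc] at k₄
    obtain ⟨m₁, m₂⟩ := set_spec hF e k₁ k₄
    have q := one_le_lg ((F.strings f).str h).length
    simp only [exec, val_step, time_step, Timed.val_bind, Timed.time_bind, Timed.val_pure,
      Timed.time_pure, Op.spec, Op.bound]
    refine ⟨by rw [strings_set, k₂, ← s, d], m₁, ?_, fun _ => by rw [k₃, s]⟩
    rw [← s] at m₂
    have : (0 : ℝ) ≤ (j + 1 - i : ℕ) := by positivity
    push_cast
    linarith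
  | substitute h i c =>
    obtain ⟨l, hi, hi'⟩ := ho
    obtain ⟨e, w, s, -⟩ := exists_of_live hF l
    obtain ⟨k₁, k₂, k₃⟩ := substitute_spec hf c w hi (s ▸ hi')
    obtain ⟨m₁, m₂⟩ := set_spec hF e k₁ k₃
    have q := one_le_lg ((F.strings f).str h).length
    simp only [exec, val_step, time_step, Timed.val_bind, Timed.time_bind, Timed.val_pure,
      Timed.time_pure, Op.spec, Op.bound]
    refine ⟨by rw [strings_set, k₂, ← s], m₁, ?_, fun _ => trivial⟩
    rw [← s] at m₂
    push_cast
    linarith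
  | insert h i c =>
    obtain ⟨l, hi, hi'⟩ := ho
    obtain ⟨e, w, s, -⟩ := exists_of_live hF l
    obtain ⟨k₁, k₂, k₃⟩ := insert_spec hf c w hi (s ▸ hi')
    obtain ⟨m₁, m₂⟩ := set_spec hF e k₁ k₃
    have q := one_le_lg ((F.strings f).str h).length
    simp only [exec, val_step, time_step, Timed.val_bind, Timed.time_bind, Timed.val_pure,
      Timed.time_pure, Op.spec, Op.bound]
    refine ⟨by rw [strings_set, k₂, ← s], m₁, ?_, fun _ => trivial⟩
    rw [← s] at m₂
    push_cast
    linarith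
  | delete h i =>
    obtain ⟨l, hi, hi'⟩ := ho
    obtain ⟨e, w, s, -⟩ := exists_of_live hF l
    obtain ⟨k₁, k₂, k₃⟩ := delete_spec hf w hi (s ▸ hi')
    obtain ⟨m₁, m₂⟩ := set_spec hF e k₁ k₃
    have q := one_le_lg ((F.strings f).str h).length
    simp only [exec, val_step, time_step, Timed.val_bind, Timed.time_bind, Timed.val_pure,
      Timed.time_pure, Op.spec, Op.bound]
    refine ⟨by rw [strings_set, k₂, ← s], m₁, ?_, fun _ => trivial⟩
    rw [← s] at m₂
    push_cast
    linarith
  | reverse h i j =>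
    obtain ⟨l, hr⟩ := ho
    obtain ⟨e, w, s, -⟩ := exists_of_live hF l
    obtain ⟨k₁, k₂, k₃⟩ := reverse_spec hf w (s ▸ hr)
    obtain ⟨m₁, m₂⟩ := set_spec hF e k₁ k₃
    have q := one_le_lg ((F.strings f).str h).length
    simp only [exec, val_step, time_step, Timed.val_bind, Timed.time_bind, Timed.val_pure,
      Timed.time_pure, Op.spec, Op.bound]
    refine ⟨by rw [strings_set, k₂, ← s], m₁, ?_, fun _ => trivial⟩
    rw [← s] at m₂
    push_cast
    linarith
  | map h i j =>
    obtain ⟨l, hr⟩ := ho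
    obtain ⟨e, w, s, -⟩ := exists_of_live hF l
    obtain ⟨k₁, k₂, k₃⟩ := map_spec hf w (s ▸ hr)
    obtain ⟨m₁, m₂⟩ := set_spec hF e k₁ k₃
    have q := one_le_lg ((F.strings f).str h).length
    simp only [exec, val_step, time_step, Timed.val_bind, Timed.time_bind, Timed.val_pure,
      Timed.time_pure, Op.spec, Op.bound]
    refine ⟨by rw [strings_set, k₂, ← s], m₁, ?_, fun _ => trivial⟩
    rw [← s] at m₂
    push_cast
    linarith

theorem time_exec_makeString (hf : Function.Involutive f) (F : Forest a p) (w : List (Fin a)) :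
    (exec b f F (.makeString w)).time = 2 * w.length + 2 := by
  simp [exec, (makeString_spec (b := b) hf w).2.2.1]

theorem time_exec_retrieve_le (hf : Function.Involutive f) {F : Forest a p}
    (hF : F.WellFormed b f) {h i j : ℕ}
    (hv : (Op.retrieve h i j : Op a).Valid (F.strings f)) :
    (exec b f F (.retrieve h i j)).time ≤
      (isolate b f (F.tree h) i j).time + (2 * (j + 1 - i) + 4) := by
  obtain ⟨l, hr⟩ := hv
  obtain ⟨-, w, s, -⟩ := exists_of_live hF l
  have := (retrieve_spec hf w (s ▸ hr)).2.2.2.1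
  simp [exec]
  omega

/-- The potential after each operation is the potential before the next, so the amortized bounds
telescope. -/
theorem runFrom_spec (hf : Function.Involutive f) (ops : List (Op a)) {F : Forest a p}
    (hF : F.WellFormed b f) (hv : ValidFrom f (F.strings f) ops) :
    (runFrom b f F ops).strings f = collectionFrom f (F.strings f) ops ∧
      (runFrom b f F ops).WellFormed b f ∧
      timeFrom b f F ops + 2 * (runFrom b f F ops).pot ≤
        2 * F.pot + 100 * boundFrom f (F.strings f) ops := by
  induction ops generalizing F with
  | nil => exact ⟨rfl, hF, by simp [timeFrom, runFrom, boundFrom]⟩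
  | cons o ops ih =>
    obtain ⟨ho, hv⟩ := hv
    obtain ⟨h₁, h₂, h₃, -⟩ := exec_spec hf hF o ho
    obtain ⟨k₁, k₂, k₃⟩ := ih h₂ (h₁ ▸ hv)
    rw [h₁] at k₁ k₃
    refine ⟨k₁, k₂, ?_⟩
    simp only [timeFrom, runFrom, boundFrom]
    push_cast
    linarith

end Forest
/-! ### Substring equality with high probability -/

section Probability

open Polynomial

variable {a p : ℕ}

/-- The polynomial whose value at the base is the fingerprint. -/
noncomputable def fingerprintPoly (p : ℕ) : List (Fin a) → (ZMod p)[X]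
  | [] => 0
  | c :: s => C (code p c) * X ^ s.length + fingerprintPoly p s

theorem eval_fingerprintPoly (b : ZMod p) (s : List (Fin a)) :
    (fingerprintPoly p s).eval b = fingerprint b s := by
  induction s with
  | nil => simp [fingerprintPoly]
  | cons c s ih => simp [fingerprintPoly, fingerprint_cons, ih]

theorem degree_fingerprintPoly_lt (s : List (Fin a)) :
    (fingerprintPoly p s).degree < s.length := by
  induction s with
  | nil => simp [fingerprintPoly]
  | cons c s ih =>
    rw [fingerprintPoly, List.length_cons]
    have h : ((s.length : ℕ) : WithBot ℕ) < ((s.length + 1 : ℕ) : WithBot ℕ) := by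
      exact_mod_cast Nat.lt_succ_self _
    exact (degree_add_le _ _).trans_lt
      (max_lt ((degree_C_mul_X_pow_le _ _).trans_lt h) (ih.trans h))

/-- The symbols are `a` consecutive integers and `a ≤ p`, hence distinct modulo `p`; for `a = p` one
of them is 0, which is harmless as lengths are compared separately. -/
theorem code_injective (hp : p.Prime) (ha : a ≤ p) :
    Function.Injective (code p : Fin a → ZMod p) := by
  intro c d h
  have : Fact p.Prime := ⟨hp⟩
  simp only [code, Nat.cast_add, Nat.cast_one, add_left_inj] at h
  have h' := congrArg ZMod.val h
  rw [ZMod.val_cast_of_lt (c.2.trans_le ha), ZMod.val_cast_of_lt (d.2.trans_le ha)] at h'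
  exact Fin.ext h'

/-- The coefficient at the top exponent recovers the first symbol. Equal lengths are needed to line
up these exponents. -/
theorem fingerprintPoly_injOn (hp : p.Prime) (ha : a ≤ p) {s t : List (Fin a)}
    (hl : s.length = t.length) (h : fingerprintPoly p s = fingerprintPoly p t) : s = t := by
  induction s generalizing t with
  | nil => exact (List.length_eq_zero_iff.1 hl.symm).symm
  | cons c s ih =>
    cases t with
    | nil => simp at hl
    | cons d t =>
      have hl' : s.length = t.length := by simpa using hl
      have hc := congrArg (fun q => q.coeff s.length) h
      simp only [fingerprintPoly, coeff_add, coeff_C_mul_X_pow, if_true, hl',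
        coeff_eq_zero_of_degree_lt (degree_fingerprintPoly_lt t),
        coeff_eq_zero_of_degree_lt (hl' ▸ degree_fingerprintPoly_lt s :
          (fingerprintPoly p s).degree < (t.length : ℕ)), add_zero] at hc
      have e := code_injective hp ha hc
      subst e
      rw [fingerprintPoly, fingerprintPoly, hl', add_right_inj] at h
      rw [ih hl' h]

/-- Two different strings of the same length have the same fingerprint for few bases only. -/
theorem card_collisions_lt (hp : p.Prime) (ha : a ≤ p) {s t : List (Fin a)}
    (hl : s.length = t.length) (hst : s ≠ t) :
    ((Finset.Icc 1 (p - 1)).filter fun b : ℕ =>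
      fingerprint (b : ZMod p) s = fingerprint (b : ZMod p) t).card < s.length := by
  have : Fact p.Prime := ⟨hp⟩
  set q := fingerprintPoly p s - fingerprintPoly p t with hq
  have hq0 : q ≠ 0 := fun h => hst (fingerprintPoly_injOn hp ha hl (sub_eq_zero.1 h))
  have hdeg : q.degree < s.length := by
    refine (degree_sub_le _ _).trans_lt (max_lt (degree_fingerprintPoly_lt s) ?_)
    rw [hl]; exact degree_fingerprintPoly_lt t
  have hcard : q.roots.toFinset.card < s.length := by
    have h := (Nat.cast_le.2 q.roots.toFinset_card_le).trans (card_roots hq0)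
    exact_mod_cast h.trans_lt hdeg
  -- Each colliding base is a root of `q`, and reduction modulo `p` is injective on `[1..p-1]`.
  refine lt_of_le_of_lt (Finset.card_le_card_of_injOn (fun b : ℕ => (b : ZMod p)) ?_ ?_) hcard
  · intro b hb
    have hb' := (Finset.mem_filter.1 (Finset.mem_coe.1 hb)).2
    rw [Finset.mem_coe, Multiset.mem_toFinset, mem_roots hq0]
    simp [hq, eval_fingerprintPoly, hb']
  · intro b hb b' hb' h
    have h₁ := Finset.mem_Icc.1 (Finset.mem_filter.1 (Finset.mem_coe.1 hb)).1
    have h₂ := Finset.mem_Icc.1 (Finset.mem_filter.1 (Finset.mem_coe.1 hb')).1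
    have h' := congrArg ZMod.val h
    simp only at h'
    rwa [ZMod.val_cast_of_lt (by omega), ZMod.val_cast_of_lt (by omega)] at h'

theorem uniformOn_fingerprint_ge (hp : p.Prime) (ha : a ≤ p) {s t : List (Fin a)} {N c : ℕ}
    (hl : s.length = t.length) (hN : s.length ≤ N) (hNp : N ^ (c + 1) ≤ p) :
    1 - 1 / (N : ℝ) ^ c ≤ (ProbabilityTheory.uniformOn (Set.Icc 1 (p - 1) : Set ℕ)).real
      {b : ℕ | decide (fingerprint (b : ZMod p) s = fingerprint (b : ZMod p) t) =
        decide (s = t)} := by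
  have h2 := hp.two_le
  have hfin : (Set.Icc 1 (p - 1) : Set ℕ).Finite := Set.finite_Icc _ _
  have hne : (Set.Icc 1 (p - 1) : Set ℕ).Nonempty := ⟨1, by simp; omega⟩
  have := ProbabilityTheory.isProbabilityMeasure_uniformOn hfin hne
  by_cases hst : s = t
  · subst hst
    have : {b : ℕ | decide (fingerprint (b : ZMod p) s = fingerprint (b : ZMod p) s) =
        decide (s = s)} = Set.univ := by ext; simp
    rw [this, MeasureTheory.probReal_univ]
    have : (0 : ℝ) ≤ 1 / (N : ℝ) ^ c := by positivity
    linarith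
  · have hlt := card_collisions_lt hp ha hl hst
    set B := (Finset.Icc 1 (p - 1)).filter fun b : ℕ =>
      fingerprint (b : ZMod p) s = fingerprint (b : ZMod p) t with hB
    set G := {b : ℕ | decide (fingerprint (b : ZMod p) s = fingerprint (b : ZMod p) t) =
      decide (s = t)} with hG
    have hGB : Set.Icc 1 (p - 1) ∩ Gᶜ = (B : Set ℕ) := by
      ext b; simp [hG, hB, hst]
    have hbad : (ProbabilityTheory.uniformOn (Set.Icc 1 (p - 1) : Set ℕ)).real Gᶜ =
        (B.card : ℝ) / ((p - 1 : ℕ) : ℝ) := by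
      rw [MeasureTheory.Measure.real, ← ProbabilityTheory.uniformOn_inter_self hfin, hGB,
        ← Finset.coe_Icc, ProbabilityTheory.uniformOn_apply_finset,
        Finset.inter_eq_right.2 (Finset.filter_subset _ _), ENNReal.toReal_div,
        ENNReal.toReal_natCast, ENNReal.toReal_natCast, Nat.card_Icc, Nat.add_sub_cancel]
    have hG' := MeasureTheory.probReal_compl_eq_one_sub
      (μ := ProbabilityTheory.uniformOn (Set.Icc 1 (p - 1) : Set ℕ)) (s := G)
      (MeasurableSet.of_discrete)
    rw [hbad] at hG'
    suffices h : (B.card : ℝ) / ((p - 1 : ℕ) : ℝ) ≤ 1 / (N : ℝ) ^ c by linarith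
    -- Different strings of equal length are nonempty. The case `N = 0` thus arises only for equal
    -- strings, where the probability is 1.
    have hN0 : 0 < N := by omega
    have hp1 : (0 : ℝ) < ((p - 1 : ℕ) : ℝ) := by exact_mod_cast (by omega : 0 < p - 1)
    rw [div_le_div_iff₀ hp1 (by positivity), one_mul]
    -- There are at most `N - 1` bad bases, and `(N - 1) N ^ c = N ^ (c + 1) - N ^ c ≤ p - 1`. The
    -- strict bound on collisions makes up for the base 0 being excluded.
    have h₁ : (B.card + 1) * N ^ c ≤ N ^ (c + 1) := by
      rw [pow_succ, mul_comm]
      exact Nat.mul_le_mul_left _ (by omega)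
    have h₂ : 1 ≤ N ^ c := Nat.one_le_pow _ _ hN0
    have h₃ : B.card * N ^ c ≤ p - 1 := by
      rw [add_mul] at h₁; omega
    exact_mod_cast h₃

end Probability

theorem Collection.length_str_le_total {a : ℕ} (D : Collection a) (h : ℕ) :
    (D.str h).length ≤ D.total := by
  unfold Collection.str
  cases e : lookup D h with
  | none => simp
  | some s =>
    refine List.single_le_sum (by simp) _ (List.mem_map.2 ⟨some s, ?_, rfl⟩)
    exact List.mem_of_getElem? (getElem?_of_lookup e)

end FeST

/-! ### The main theorem -/

theorem mainTheorem1 :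
    ∃ C : ℝ, 0 < C ∧
      ∀ (a p : ℕ) (f : Fin a → Fin a), p.Prime → a ≤ p → Function.Involutive f →
      ∀ ops : List (FeST.Op a), FeST.ValidFrom f [] ops →
        -- what holds for every base, after every legal sequence of operations
        (∀ b : ZMod p,
          -- the forest represents the collection, and its nodes carry sizes and fingerprints
          (FeST.Forest.runFrom b f [] ops).strings f = FeST.collectionFrom f [] ops ∧
          (FeST.Forest.runFrom b f [] ops).WellFormed b f ∧
          -- space
          ((FeST.Forest.runFrom b f [] ops).space : ℝ) ≤
            C * ((FeST.collectionFrom f [] ops).total +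
              (FeST.collectionFrom f [] ops).numEmpty) ∧
          -- amortized time
          (FeST.Forest.timeFrom b f [] ops : ℝ) ≤ C * FeST.boundFrom f [] ops ∧
          -- the next operation answers correctly if it is not a substring comparison
          (∀ o : FeST.Op a, o.Valid (FeST.collectionFrom f [] ops) → ¬ o.IsEqual →
            (FeST.Forest.exec b f (FeST.Forest.runFrom b f [] ops) o).val.2 =
              (o.spec f (FeST.collectionFrom f [] ops)).2) ∧
          -- a negative answer to a substring comparison is always correct
          (∀ h₁ i₁ h₂ i₂ len : ℕ,
            (FeST.Op.equal h₁ i₁ h₂ i₂ len : FeST.Op a).Valid (FeST.collectionFrom f [] ops) →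
            (FeST.Forest.exec b f (FeST.Forest.runFrom b f [] ops)
              (.equal h₁ i₁ h₂ i₂ len)).val.2 = .bool false →
            ((FeST.Op.equal h₁ i₁ h₂ i₂ len).spec f (FeST.collectionFrom f [] ops)).2 =
              .bool false) ∧
          -- worst-case linear time for creating a string
          (∀ w : List (Fin a),
            ((FeST.Forest.exec b f (FeST.Forest.runFrom b f [] ops) (.makeString w)).time : ℝ) ≤
              C * (w.length + 1)) ∧
          -- retrieving: worst-case linear time on top of isolating the substring
          (∀ h i j : ℕ,
            (FeST.Op.retrieve h i j : FeST.Op a).Valid (FeST.collectionFrom f [] ops) →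
            ((FeST.Forest.exec b f (FeST.Forest.runFrom b f [] ops) (.retrieve h i j)).time : ℝ) ≤
              (FeST.isolate b f ((FeST.Forest.runFrom b f [] ops).tree h) i j).time +
                C * ((j + 1 - i : ℕ) + 1))) ∧
        -- for a uniformly random base in `[1..p-1]`, a substring comparison is correct whp
        (∀ N c : ℕ, (FeST.collectionFrom f [] ops).total ≤ N → N ^ (c + 1) ≤ p →
          ∀ h₁ i₁ h₂ i₂ len : ℕ,
            (FeST.Op.equal h₁ i₁ h₂ i₂ len : FeST.Op a).Valid (FeST.collectionFrom f [] ops) →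
            1 - 1 / (N : ℝ) ^ c ≤
              (ProbabilityTheory.uniformOn (Set.Icc 1 (p - 1) : Set ℕ)).real
                {b : ℕ |
                  (FeST.Forest.exec (b : ZMod p) f (FeST.Forest.runFrom (b : ZMod p) f [] ops)
                    (.equal h₁ i₁ h₂ i₂ len)).val.2 =
                  ((FeST.Op.equal h₁ i₁ h₂ i₂ len).spec f (FeST.collectionFrom f [] ops)).2}) := by
  refine ⟨100, by norm_num, fun a p f hp ha hf ops hv => ⟨fun b => ?_, ?_⟩⟩
  · have hF₀ : FeST.Forest.WellFormed b f ([] : FeST.Forest a p) := by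
      intro h t ht
      simp [FeST.lookup] at ht
    obtain ⟨h₁, h₂, h₃⟩ := FeST.Forest.runFrom_spec hf ops hF₀ hv
    rw [show FeST.Forest.strings f ([] : FeST.Forest a p) = [] from rfl] at h₁ h₃
    refine ⟨h₁, h₂, ?_, ?_, ?_, ?_, ?_, ?_⟩
    · have h : ((FeST.Forest.runFrom b f [] ops).space : ℝ) ≤
          12 * ((FeST.collectionFrom f [] ops).total + (FeST.collectionFrom f [] ops).numEmpty) := by
        have := FeST.Forest.space_le (f := f) (FeST.Forest.runFrom b f [] ops)
        rw [h₁] at this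
        exact_mod_cast this
      have h' : (0 : ℝ) ≤ (FeST.collectionFrom f [] ops).total + (FeST.collectionFrom f [] ops).numEmpty := by
        positivity
      linarith
    -- The potential is 0 for the empty forest and never negative, so the amortized bound is a bound
    -- on the actual time.
    · have := FeST.Forest.pot_nonneg (FeST.Forest.runFrom b f [] ops)
      have h0 : FeST.Forest.pot ([] : FeST.Forest a p) = 0 := by simp [FeST.Forest.pot]
      linarith
    · intro o ho hoe
      rw [← h₁] at ho ⊢
      exact (FeST.Forest.exec_spec hf h₂ o ho).2.2.2 hoe
    · intro k₁ i₁ k₂ i₂ len ho hans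
      rw [← h₁] at ho ⊢
      rw [(FeST.Forest.exec_equal_spec hf h₂ ho).2.2.2] at hans
      simp only [FeST.Answer.bool.injEq, decide_eq_false_iff_not] at hans
      simp only [FeST.Op.spec, FeST.Answer.bool.injEq, decide_eq_false_iff_not]
      exact fun e => hans (by rw [e])
    · intro w
      rw [FeST.Forest.time_exec_makeString hf]
      have : (0 : ℝ) ≤ w.length := by positivity
      push_cast
      linarith
    · intro h i j ho
      rw [← h₁] at ho
      have h : ((FeST.Forest.exec b f (FeST.Forest.runFrom b f [] ops) (.retrieve h i j)).time : ℝ) ≤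
          (FeST.isolate b f ((FeST.Forest.runFrom b f [] ops).tree h) i j).time +
            (2 * (j + 1 - i : ℕ) + 4) := by
        exact_mod_cast FeST.Forest.time_exec_retrieve_le hf h₂ ho
      have h' : (0 : ℝ) ≤ (j + 1 - i : ℕ) := by positivity
      linarith
  · intro N c hN hNp k₁ i₁ k₂ i₂ len ho
    set D := FeST.collectionFrom f [] ops with hD
    have hl : ∀ k i, 1 ≤ i → i + len ≤ (D.str k).length + 1 →
        (FeST.substring (D.str k) i (i + len - 1)).length = len := by
      intro k i hi hi'
      simp only [FeST.substring, List.length_take, List.length_drop]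
      omega
    obtain ⟨-, -, o₁, o₂, o₃, o₄⟩ := id ho
    have l₁ := hl k₁ i₁ o₁ o₂
    have l₂ := hl k₂ i₂ o₃ o₄
    have hk := D.length_str_le_total k₁
    -- The abstract collection does not depend on the base, so the same two substrings are compared
    -- for every `b`. It remains to identify the event, base by base, with correctness of the
    -- comparison of fingerprints.
    convert FeST.uniformOn_fingerprint_ge hp ha (l₁.trans l₂.symm) (by omega : _ ≤ N) hNp using 4 with b
    have hF₀ : FeST.Forest.WellFormed (b : ZMod p) f ([] : FeST.Forest a p) := by
      intro h t ht
      simp [FeST.lookup] at ht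
    obtain ⟨h₁, h₂, -⟩ := FeST.Forest.runFrom_spec hf ops hF₀ hv
    rw [show FeST.Forest.strings f ([] : FeST.Forest a p) = [] from rfl, ← hD] at h₁
    have := (FeST.Forest.exec_equal_spec (i₁ := i₁) (i₂ := i₂) (len := len) (h₁ := k₁) (h₂ := k₂) hf h₂
      (h₁.symm ▸ ho)).2.2.2
    rw [this, h₁]
    simp only [FeST.Op.spec, FeST.Answer.bool.injEq]
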